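/- Let $p$ be a prime, let $k$ be an algebraically closed field of characteristic different from $p$, let $\zeta\in k^\times$ be a primitive $p$th root of unity, and let $r$ be a positive integer. Let $F_r := k((t_1))((t_2))\ldots((t_{2r}))$ be the iterated Laurent series field in $2r$ variables over $k$. For $u,v\in F_r^\times$ let $(u,v)_p$ be the $F_r$-algebra generated by two elements $x,y$ modulo the relations $x^p=u$, $y^p=v$, $xy=\zeta yx$, and put $$D_r := (t_1,t_2)_p\otimes_{F_r}(t_3,t_4)_p\otimes_{F_r}\cdots\otimes_{F_r}(t_{2r-1},t_{2r})_p.$$ Let $F'/F_r$ be a finite field extension whose degree is not divisible by $p$, and let $L/F'$ be a finite Galois extension such that $D_r\otimes_{F_r}L$ is split, i.e. isomorphic as an $L$-algebra to a matrix algebra $M_n(L)$ for some $n\geq 1$. Then the Galois group $\mathrm{Gal}(L/F')$ contains a subgroup isomorphic to $(\mathbb Z/p\mathbb Z)^r$. In other words, $\mathrm{rank}_p(\mathrm{Gal}(L/F'))\geq r$, where the $p$-rank $\mathrm{rank}_p(\Gamma)$ of a finite group $\Gamma$ is the largest integer $s\geq 0$ such that $\Gamma$ has a subgroup isomorphic to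 $(\mathbb Z/p\mathbb Z)^s$. -/

import Mathlib

open scoped TensorProduct

universe u v w

noncomputable section

/-- The iterated Laurent series field `k((t₁))((t₂))…((tₙ))`, bundled with its field structure:
`k` for `n = 0`, and Laurent series over the previous field at each further step. -/
def iteratedLaurentBundled (k : Type u) [Field k] : ℕ → (K : Type u) × Field K
  | 0 => ⟨k, inferInstance⟩
  | n + 1 =>
    letI : Field (iteratedLaurentBundled k n).1 := (iteratedLaurentBundled k n).2
    ⟨LaurentSeries (iteratedLaurentBundled k n).1, inferInstance⟩

/-- The iterated Laurent series field `k((t₁))((t₂))…((tₙ))`. -/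
def IteratedLaurent (k : Type u) [Field k] (n : ℕ) : Type u :=
  (iteratedLaurentBundled k n).1

instance IteratedLaurent.instField (k : Type u) [Field k] (n : ℕ) :
    Field (IteratedLaurent k n) :=
  (iteratedLaurentBundled k n).2

/-- The inclusion of `k((t₁))…((tₙ))` in `k((t₁))…((tₙ))((tₙ₊₁))` as constant Laurent series. -/
def IteratedLaurent.succHom (k : Type u) [Field k] (n : ℕ) :
    IteratedLaurent k n →+* IteratedLaurent k (n + 1) :=
  (HahnSeries.C : IteratedLaurent k n →+* LaurentSeries (IteratedLaurent k n))

/-- The inclusion of the base field `k` in `k((t₁))…((tₙ))`. -/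
def IteratedLaurent.const (k : Type u) [Field k] : (n : ℕ) → k →+* IteratedLaurent k n
  | 0 => RingHom.id k
  | n + 1 => (IteratedLaurent.succHom k n).comp (IteratedLaurent.const k n)

/-- The newest variable `tₙ₊₁` of `k((t₁))…((tₙ))((tₙ₊₁))`. -/
def IteratedLaurent.lastVar (k : Type u) [Field k] (n : ℕ) : IteratedLaurent k (n + 1) :=
  (HahnSeries.single (1 : ℤ) (1 : IteratedLaurent k n) : LaurentSeries (IteratedLaurent k n))

/-- The variables of `k((t₁))…((tₙ))`, indexed from `0`: `IteratedLaurent.var k n i` is the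
variable `tᵢ₊₁`. -/
def IteratedLaurent.var (k : Type u) [Field k] : (n : ℕ) → Fin n → IteratedLaurent k n
  | 0 => Fin.elim0
  | n + 1 => Fin.snoc (α := fun _ => IteratedLaurent k (n + 1))
      (fun i => IteratedLaurent.succHom k n (IteratedLaurent.var k n i))
      (IteratedLaurent.lastVar k n)

/-- The defining relations of the symbol algebra `(a, b)_p`, on the free algebra on
`x = ι 0` and `y = ι 1`: `x ^ p = a`, `y ^ p = b` and `x y = ζ y x`. -/
inductive SymbolAlgebra.Rel {F : Type u} [Field F] (p : ℕ) (ζ a b : F) :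
    FreeAlgebra F (Fin 2) → FreeAlgebra F (Fin 2) → Prop
  | pow_x : SymbolAlgebra.Rel p ζ a b
      (FreeAlgebra.ι F (0 : Fin 2) ^ p) (algebraMap F (FreeAlgebra F (Fin 2)) a)
  | pow_y : SymbolAlgebra.Rel p ζ a b
      (FreeAlgebra.ι F (1 : Fin 2) ^ p) (algebraMap F (FreeAlgebra F (Fin 2)) b)
  | comm : SymbolAlgebra.Rel p ζ a b
      (FreeAlgebra.ι F (0 : Fin 2) * FreeAlgebra.ι F (1 : Fin 2))
      (ζ • (FreeAlgebra.ι F (1 : Fin 2) * FreeAlgebra.ι F (0 : Fin 2)))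

/-- The symbol algebra `(a, b)_p` over `F`, with respect to `ζ ∈ F`: the `F`-algebra generated by
`x, y` modulo the relations `x ^ p = a`, `y ^ p = b`, `x y = ζ y x`. -/
def SymbolAlgebra {F : Type u} [Field F] (p : ℕ) (ζ a b : F) : Type u :=
  RingQuot (SymbolAlgebra.Rel p ζ a b)

instance SymbolAlgebra.instRing {F : Type u} [Field F] (p : ℕ) (ζ a b : F) :
    Ring (SymbolAlgebra p ζ a b) :=
  inferInstanceAs (Ring (RingQuot (SymbolAlgebra.Rel p ζ a b)))

instance SymbolAlgebra.instAlgebra {F : Type u} [Field F] (p : ℕ) (ζ a b : F) :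
    Algebra F (SymbolAlgebra p ζ a b) :=
  inferInstanceAs (Algebra F (RingQuot (SymbolAlgebra.Rel p ζ a b)))

/-- The algebra `D_r = (t₁, t₂)_p ⊗ (t₃, t₄)_p ⊗ … ⊗ (t₂ᵣ₋₁, t₂ᵣ)_p` over
`F_r = k((t₁))…((t₂ᵣ))`. The variables are indexed from `0`, so the factor with index `i`
(`0 ≤ i < r`) is formed from the variables with indices `2 i` and `2 i + 1`. -/
abbrev SymbolTensor (k : Type u) [Field k] (p : ℕ) (ζ : k) (r : ℕ) : Type u :=
  ⨂[IteratedLaurent k (2 * r)] i : Fin r,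
    SymbolAlgebra p (IteratedLaurent.const k (2 * r) ζ)
      (IteratedLaurent.var k (2 * r) ⟨2 * i.val, by have := i.isLt; omega⟩)
      (IteratedLaurent.var k (2 * r) ⟨2 * i.val + 1, by have := i.isLt; omega⟩)

/-- The field extension `L` of `F` splits the `F`-algebra `D`: the `L`-algebra `L ⊗ D` obtained by
extension of scalars is isomorphic to a matrix algebra over `L`. -/
def IsSplitBy (F : Type u) [Field F] (D : Type v) [Ring D] [Algebra F D]
    (L : Type w) [Field L] [Algebra F L] : Prop :=
  ∃ n : ℕ, 0 < n ∧ Nonempty (L ⊗[F] D ≃ₐ[L] Matrix (Fin n) (Fin n) L)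

/-- `G` has a subgroup isomorphic to `(ℤ/pℤ)^s`. -/
def HasElementaryAbelianSubgroup (p : ℕ) (G : Type u) [Group G] (s : ℕ) : Prop :=
  ∃ H : Subgroup G, Nonempty (H ≃* Multiplicative (Fin s → ZMod p))

/-- The `p`-rank of a finite group `G`: the largest `s` such that `G` has a subgroup isomorphic to
`(ℤ/pℤ)^s`. -/
def pRank (p : ℕ) (G : Type u) [Group G] : ℕ :=
  sSup {s : ℕ | HasElementaryAbelianSubgroup p G s}

end

/-! For a field K write Cl(K) = Kˣ/(Kˣ)ᵖ, a vector space over 𝔽_p. By Sylow theory, F' may be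
replaced by an extension K of degree prime to p over F_r, with L/K Galois of p-power order and group
G. The aim is to show that at least pʳ classes of Cl(K) die in L.

Power classes. Every finite extension of F_r has dim Cl ≤ 2r (`IteratedLaurent.coveredByPow`): one
inducts on the number of variables, using that the value group is cyclic and that elements close to
1 are p-th powers. Norms show that the 2r variables stay independent in Cl(K), so the bound is
attained there. In a Kummer step M(b)/M with bᵖ = a, one class, that of a, dies, and one new class,
that of b, appears. The bound then forces Cl(M(b)) to be spanned by the image of Cl(M) and b
(`range_sup_span_and_finrank`). Consequently L is generated over K by radicals of p-power exponent,
so G is abelian (`IsRadicalStep.top`); and norms from M(b) are powers of a modulo p-th powers, so a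
symbol algebra with independent entries has no nonzero module of dimension ≤ p
(`lt_finrank_of_symbol`).

Symbols. Monomials in the generators of D_r are indexed by V = 𝔽_p^(2r); their commutators give a
symplectic form on V and their p-th powers a linear map q : V → Cl(L). Splitting yields a nonzero
module of dimension ≤ pʳ. If dim ker q < r, the orthogonal of ker q contains a hyperbolic pair x, y.
A suitable extension of L kills the classes of a Lagrangian of ⟨x, y⟩^⊥ but keeps q(x), q(y)
independent. The r - 1 symbols that become split each divide the dimension by p, leaving a nonzero
module of dimension ≤ p over a symbol with independent entries, which is impossible
(`le_finrank_ker_of_symbols`).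

Conclusion. So dim ker q ≥ r, and ker q embeds in the kernel of Cl(K) → Cl(L). By Kummer theory the
elements of that kernel are distinct characters of G/Gᵖ (`card_ker_map_le`), and |G[p]| = |G/Gᵖ| ≥
pʳ for the finite abelian group G. -/

noncomputable section

/-! ### Power classes of a field. -/

/-- The group `Kˣ / (Kˣ)ᵖ` of `p`-th power classes of a field, written additively. -/
def PowClass (p : ℕ) (K : Type*) [Field K] : Type _ :=
  Additive (Kˣ ⧸ (powMonoidHom p : Kˣ →* Kˣ).range)

instance PowClass.instAddCommGroup (p : ℕ) (K : Type*) [Field K] : AddCommGroup (PowClass p K) :=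
  inferInstanceAs (AddCommGroup (Additive (Kˣ ⧸ (powMonoidHom p : Kˣ →* Kˣ).range)))

namespace PowClass

variable {p : ℕ} {K : Type*} [Field K]

/-- The class of a unit modulo `p`-th powers. -/
def mk (p : ℕ) (x : Kˣ) : PowClass p K := Additive.ofMul (QuotientGroup.mk x)

theorem mk_surjective : Function.Surjective (mk p : Kˣ → PowClass p K) := fun x => by
  induction x using Additive.rec with | _ x
  induction x using QuotientGroup.induction_on with | H x
  exact ⟨x, rfl⟩

@[simp] theorem mk_mul (x y : Kˣ) : mk p (x * y) = mk p x + mk p y := rfl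

@[simp] theorem mk_one : mk p (1 : Kˣ) = 0 := rfl

@[simp] theorem mk_inv (x : Kˣ) : mk p x⁻¹ = -mk p x := rfl

@[simp] theorem mk_pow (x : Kˣ) (n : ℕ) : mk p (x ^ n) = n • mk p x := rfl

theorem mk_eq_zero {x : Kˣ} : mk p x = 0 ↔ ∃ y : Kˣ, y ^ p = x :=
  (ofMul_eq_zero).trans (QuotientGroup.eq_one_iff _)

theorem mk_eq_zero' (hp : p ≠ 0) {x : Kˣ} : mk p x = 0 ↔ ∃ y : K, y ^ p = x := by
  rw [mk_eq_zero]
  refine ⟨fun ⟨y, hy⟩ => ⟨y, by rw [← hy]; simp⟩, fun ⟨y, hy⟩ => ?_⟩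
  have hy0 : y ≠ 0 := by
    rintro rfl
    rw [zero_pow hp] at hy
    exact x.ne_zero hy.symm
  exact ⟨Units.mk0 y hy0, Units.ext (by simpa using hy)⟩

theorem mk_eq_mk {x y : Kˣ} : mk p x = mk p y ↔ ∃ z : Kˣ, x = y * z ^ p := by
  rw [← sub_eq_zero, sub_eq_add_neg, ← mk_inv, ← mk_mul, mk_eq_zero]
  constructor
  · rintro ⟨z, hz⟩
    exact ⟨z, by rw [hz, mul_comm x, mul_inv_cancel_left]⟩
  · rintro ⟨z, hz⟩
    exact ⟨z, by rw [hz, mul_comm y, mul_inv_cancel_right]⟩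

@[simp] theorem mk_pow_self (x : Kˣ) : mk p (x ^ p) = 0 := mk_eq_zero.mpr ⟨x, rfl⟩

instance instModule : Module (ZMod p) (PowClass p K) :=
  AddCommGroup.zmodModule fun x => by
    obtain ⟨x, rfl⟩ := mk_surjective x
    rw [← mk_pow, mk_pow_self]

theorem zmod_smul_mk [NeZero p] (i : ZMod p) (x : Kˣ) : i • mk p x = mk p (x ^ i.val) := by
  rw [mk_pow, ← Nat.cast_smul_eq_nsmul (ZMod p) i.val, ZMod.natCast_zmod_val]

/-- The map on `p`-th power classes induced by a homomorphism on unit groups. -/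
def mapHom {K' : Type*} [Field K'] (f : Kˣ →* K'ˣ) : PowClass p K →ₗ[ZMod p] PowClass p K' :=
  AddMonoidHom.toZModLinearMap (M := PowClass p K) (M₁ := PowClass p K') p <|
    MonoidHom.toAdditive (QuotientGroup.map (powMonoidHom p : Kˣ →* Kˣ).range
      (powMonoidHom p : K'ˣ →* K'ˣ).range f (by
        rintro _ ⟨x, rfl⟩
        exact ⟨f x, by simp⟩))

@[simp] theorem mapHom_mk {K' : Type*} [Field K'] (f : Kˣ →* K'ˣ) (x : Kˣ) :
    mapHom f (mk p x) = mk p (f x) := rfl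

/-- The map on `p`-th power classes induced by a field extension. -/
abbrev map (p : ℕ) (K K' : Type*) [Field K] [Field K'] [Algebra K K'] :
    PowClass p K →ₗ[ZMod p] PowClass p K' :=
  mapHom (Units.map (algebraMap K K' : K →* K'))

theorem map_mk_eq_zero {K' : Type*} [Field K'] [Algebra K K'] (hp : p ≠ 0) (x : Kˣ) :
    map p K K' (mk p x) = 0 ↔ ∃ y : K', y ^ p = algebraMap K K' x := by
  rw [mapHom_mk, mk_eq_zero' hp]; rfl

theorem map_map (K' K'' : Type*) [Field K'] [Field K''] [Algebra K K'] [Algebra K' K'']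
    [Algebra K K''] [IsScalarTower K K' K''] (x : PowClass p K) :
    map p K' K'' (map p K K' x) = map p K K'' x := by
  obtain ⟨x, rfl⟩ := mk_surjective x
  simp only [mapHom_mk]
  congr 1
  ext
  simp [← IsScalarTower.algebraMap_apply]

/-- Extension followed by the norm is multiplication by the degree, which is invertible modulo p. -/
theorem map_injective_of_coprime (K' : Type*) [Field K'] [Algebra K K'] [FiniteDimensional K K']
    (hp : p.Prime) (h : ¬ p ∣ Module.finrank K K') : Function.Injective (map p K K') := by
  rw [← LinearMap.ker_eq_bot, LinearMap.ker_eq_bot']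
  intro x hx
  obtain ⟨x, rfl⟩ := mk_surjective x
  have hN : mapHom (p := p) (Units.map (Algebra.norm K : K' →* K)) (map p K K' (mk p x)) = 0 := by
    rw [hx, map_zero]
  have : Units.map (Algebra.norm K : K' →* K) (Units.map (algebraMap K K' : K →* K') x) =
      x ^ Module.finrank K K' := by
    ext; simp [Algebra.norm_algebraMap]
  rw [mapHom_mk, mapHom_mk, this, mk_pow, ← Nat.cast_smul_eq_nsmul (ZMod p)] at hN
  have : Fact p.Prime := ⟨hp⟩
  refine (smul_eq_zero.mp hN).resolve_left ?_
  rwa [ZMod.natCast_eq_zero_iff]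

end PowClass

/-! ### Kummer extensions of degree p and their power classes. -/

/-- `b` generates `K₁` over `K`, `b ^ p = a` and `a` is not a `p`-th power in `K`, where `K`
contains the primitive `p`-th root of unity `z ^ p`. -/
structure IsKummerGenerator {K K₁ : Type*} [Field K] [Field K₁] [Algebra K K₁] (p : ℕ) (z a : K)
    (b : K₁) : Prop where
  prime : p.Prime
  primitive : IsPrimitiveRoot (z ^ p) p
  not_pow : ∀ c : K, c ^ p ≠ a
  pow_eq : b ^ p = algebraMap K K₁ a
  adjoin_eq_top : IntermediateField.adjoin K {b} = ⊤

/-- This is one reason for writing the root of unity as `z ^ p`: signs, as well as powers of the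
root of unity, then vanish in the power classes, even for p = 2. -/
theorem exists_pow_eq_neg_one {K : Type*} [Field K] {p : ℕ} (hp : p.Prime) {z : K}
    (hz : IsPrimitiveRoot (z ^ p) p) : ∃ y : K, y ^ p = -1 := by
  rcases hp.eq_two_or_odd' with rfl | h
  · exact ⟨z, hz.eq_neg_one_of_two_right⟩
  · exact ⟨-1, h.neg_one_pow⟩

namespace IsKummerGenerator

open Polynomial

variable {K K₁ : Type*} [Field K] [Field K₁] [Algebra K K₁] {p : ℕ} {z a : K} {b : K₁}
  (h : IsKummerGenerator p z a b)
include h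

theorem irreducible : Irreducible (X ^ p - C a) :=
  X_pow_sub_C_irreducible_of_prime h.prime h.not_pow

theorem minpoly_eq : minpoly K b = X ^ p - C a :=
  (minpoly.eq_of_irreducible_of_monic h.irreducible (by simp [h.pow_eq])
    (monic_X_pow_sub_C _ h.prime.ne_zero)).symm

theorem isIntegral : IsIntegral K b :=
  ⟨X ^ p - C a, monic_X_pow_sub_C _ h.prime.ne_zero, by simp [h.pow_eq]⟩

theorem base_ne_zero : a ≠ 0 := fun h0 => h.not_pow 0 (by rw [h0, zero_pow h.prime.ne_zero])

theorem gen_ne_zero : b ≠ 0 := by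
  rintro rfl
  have := h.pow_eq
  rw [zero_pow h.prime.ne_zero, eq_comm, map_eq_zero] at this
  exact h.base_ne_zero this

/-- The power basis `1, b, …, b ^ (p - 1)`. -/
def powerBasis : PowerBasis K K₁ :=
  PowerBasis.ofAdjoinEqTop h.isIntegral (by
    rw [← IntermediateField.adjoin_simple_toSubalgebra_of_isAlgebraic h.isIntegral.isAlgebraic,
      h.adjoin_eq_top, IntermediateField.top_toSubalgebra])

@[simp] theorem powerBasis_gen : h.powerBasis.gen = b := PowerBasis.ofAdjoinEqTop_gen _ _

theorem powerBasis_dim : h.powerBasis.dim = p := by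
  rw [← h.powerBasis.natDegree_minpoly, powerBasis_gen, h.minpoly_eq, natDegree_X_pow_sub_C]

theorem finiteDimensional : FiniteDimensional K K₁ := h.powerBasis.finite

theorem finrank_eq : Module.finrank K K₁ = p := by
  rw [h.powerBasis.finrank, h.powerBasis_dim]

theorem norm_gen : Algebra.norm K b = (-1) ^ (p + 1) * a := by
  have h1 := Algebra.PowerBasis.norm_gen_eq_coeff_zero_minpoly h.powerBasis
  rw [powerBasis_gen, h.minpoly_eq, powerBasis_dim] at h1
  rw [h1]
  simp [coeff_X_pow, h.prime.ne_zero.symm, pow_succ]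

theorem exists_algEquiv : ∃ σ : K₁ ≃ₐ[K] K₁, σ b = algebraMap K K₁ (z ^ p) * b := by
  have := h.finiteDimensional
  have hy : aeval (algebraMap K K₁ (z ^ p) * b) (minpoly K h.powerBasis.gen) = 0 := by
    rw [powerBasis_gen, h.minpoly_eq, map_sub, aeval_X_pow, aeval_C, mul_pow, h.pow_eq,
      ← map_pow _ (z ^ p), h.primitive.pow_eq_one, map_one, one_mul, sub_self]
  refine ⟨AlgEquiv.ofBijective (h.powerBasis.lift _ hy)
    (Algebra.IsAlgebraic.algHom_bijective _), ?_⟩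
  have := h.powerBasis.lift_gen _ hy
  rwa [powerBasis_gen] at this

/-- An element whose `p`-th power lies in the base field is a scalar times a power of `b`. -/
theorem exists_eq_mul_pow {d : K₁} {c : K} (hd : d ^ p = algebraMap K K₁ c) :
    ∃ (i : ℕ) (e : K), d = algebraMap K K₁ e * b ^ i := by
  classical
  have := h.finiteDimensional
  have : NeZero p := ⟨h.prime.ne_zero⟩
  rcases eq_or_ne d 0 with rfl | hd0
  · exact ⟨0, 0, by simp⟩
  obtain ⟨σ, hσ⟩ := h.exists_algEquiv
  -- The automorphism σ fixes d ^ p, so it multiplies d by a p-th root of unity.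
  obtain ⟨i, hi, hi'⟩ : ∃ i < p, algebraMap K K₁ (z ^ p) ^ i = σ d / d := by
    refine (h.primitive.map_of_injective (algebraMap K K₁).injective).eq_pow_of_pow_eq_one ?_
    have hc : algebraMap K K₁ c ≠ 0 := by rw [← hd]; exact pow_ne_zero _ hd0
    rw [div_pow, ← map_pow, hd, AlgEquiv.commutes, div_self hc]
  rw [eq_div_iff hd0] at hi'
  set B := h.powerBasis
  have hB : ∀ j, B.basis j = b ^ (j : ℕ) := fun j => by rw [B.basis_eq_pow, h.powerBasis_gen]
  have hsum := B.basis.sum_repr d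
  -- In the basis of powers of b, σ scales the j-th coordinate by the j-th power of the root of
  -- unity. Since σ scales d by the i-th power, only the i-th coordinate of d survives.
  have key : ∀ j : Fin B.dim, (j : ℕ) ≠ i → B.basis.repr d j = 0 := by
    intro j hj
    have h1 : σ d = ∑ j : Fin B.dim, ((z ^ p) ^ (j : ℕ) * B.basis.repr d j) • B.basis j := by
      conv_lhs => rw [← hsum]
      rw [map_sum]
      refine Finset.sum_congr rfl fun j _ => ?_
      rw [map_smul, hB, map_pow, hσ, mul_pow, mul_comm _ (B.basis.repr d j), mul_smul, ← map_pow,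
        ← Algebra.smul_def]
    have h2 : B.basis.repr (σ d) j = (z ^ p) ^ (j : ℕ) * B.basis.repr d j := by
      rw [h1, B.basis.repr_sum_self]
    rw [← hi', ← map_pow, ← Algebra.smul_def, map_smul, Finsupp.smul_apply, smul_eq_mul] at h2
    have h3 := sub_eq_zero.mpr h2
    rw [← sub_mul] at h3
    refine (mul_eq_zero.mp h3).resolve_left fun h4 => hj ?_
    exact (h.primitive.pow_inj (h.powerBasis_dim ▸ j.2) hi (sub_eq_zero.mp h4).symm)
  refine ⟨i, B.basis.repr d ⟨i, h.powerBasis_dim.symm ▸ hi⟩, ?_⟩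
  conv_lhs => rw [← hsum]
  rw [Finset.sum_eq_single ⟨i, h.powerBasis_dim.symm ▸ hi⟩, hB, Algebra.smul_def]
  · intro j _ hj
    rw [key j fun h' => hj (Fin.ext h'), zero_smul]
  · simp

/-- The unit `a` of the base field. -/
def baseUnit : Kˣ := Units.mk0 a h.base_ne_zero

/-- The generator `b` as a unit. -/
def genUnit : K₁ˣ := Units.mk0 b h.gen_ne_zero

theorem mk_baseUnit_ne_zero : PowClass.mk p h.baseUnit ≠ 0 := fun h0 => by
  obtain ⟨y, hy⟩ := (PowClass.mk_eq_zero' h.prime.ne_zero).mp h0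
  exact h.not_pow y hy

/-- If c = d ^ p with d in the extension, then d is a scalar e times b ^ i, whence c = a ^ i * e ^
p. -/
theorem ker_map : LinearMap.ker (PowClass.map p K K₁) =
    Submodule.span (ZMod p) {PowClass.mk p h.baseUnit} := by
  refine le_antisymm (fun x hx => ?_) ?_
  · obtain ⟨c, rfl⟩ := PowClass.mk_surjective x
    obtain ⟨d, hd⟩ := (PowClass.map_mk_eq_zero h.prime.ne_zero c).mp (LinearMap.mem_ker.mp hx)
    obtain ⟨i, e, he⟩ := h.exists_eq_mul_pow hd
    have hce : (c : K) = a ^ i * e ^ p := by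
      apply (algebraMap K K₁).injective
      rw [← hd, he, map_mul, map_pow, map_pow, ← h.pow_eq, mul_pow]
      ring
    have he0 : e ≠ 0 := by
      rintro rfl
      rw [zero_pow h.prime.ne_zero, mul_zero] at hce
      exact c.ne_zero hce
    have : c = h.baseUnit ^ i * (Units.mk0 e he0) ^ p := Units.ext (by simpa [baseUnit] using hce)
    rw [this, PowClass.mk_mul, PowClass.mk_pow_self, add_zero, PowClass.mk_pow]
    exact Submodule.smul_of_tower_mem _ i (Submodule.mem_span_singleton_self _)
  · rw [Submodule.span_singleton_le_iff_mem, LinearMap.mem_ker,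
      PowClass.map_mk_eq_zero h.prime.ne_zero]
    exact ⟨b, h.pow_eq⟩

/-- The norm map on power classes. -/
abbrev normMap (p : ℕ) (K K₁ : Type*) [Field K] [Field K₁] [Algebra K K₁] :
    PowClass p K₁ →ₗ[ZMod p] PowClass p K :=
  PowClass.mapHom (Units.map (Algebra.norm K : K₁ →* K))

theorem normMap_mk_gen : normMap p K K₁ (PowClass.mk p h.genUnit) = PowClass.mk p h.baseUnit := by
  obtain ⟨y, hy⟩ := exists_pow_eq_neg_one h.prime h.primitive
  have hy0 : y ≠ 0 := by
    rintro rfl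
    rw [zero_pow h.prime.ne_zero] at hy
    exact one_ne_zero (neg_eq_zero.mp hy.symm)
  have : Units.map (Algebra.norm K : K₁ →* K) h.genUnit =
      h.baseUnit * ((Units.mk0 y hy0) ^ (p + 1)) ^ p := by
    ext
    simp [genUnit, baseUnit, h.norm_gen, ← hy, ← pow_mul, mul_comm]
  rw [PowClass.mapHom_mk, this, PowClass.mk_mul, PowClass.mk_pow_self, add_zero]

theorem normMap_map (x : PowClass p K) : normMap p K K₁ (PowClass.map p K K₁ x) = 0 := by
  have := h.finiteDimensional
  obtain ⟨x, rfl⟩ := PowClass.mk_surjective x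
  have : Units.map (Algebra.norm K : K₁ →* K) (Units.map (algebraMap K K₁ : K →* K₁) x) =
      x ^ p := by
    ext; simp [Algebra.norm_algebraMap, h.finrank_eq]
  rw [PowClass.mapHom_mk, PowClass.mapHom_mk, this, PowClass.mk_pow_self]

/-- The norm kills every class coming from the base, the degree being p, but sends b to the nonzero
class of a. -/
theorem mk_gen_notMem_range :
    PowClass.mk p h.genUnit ∉ LinearMap.range (PowClass.map p K K₁) := by
  rintro ⟨x, hx⟩
  apply h.mk_baseUnit_ne_zero
  rw [← h.normMap_mk_gen, ← hx, h.normMap_map]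

section finrank

variable [Module.Finite (ZMod p) (PowClass p K)] [Module.Finite (ZMod p) (PowClass p K₁)]
  (hle : Module.finrank (ZMod p) (PowClass p K₁) ≤ Module.finrank (ZMod p) (PowClass p K))
include hle

/-- By rank-nullity the range has dimension one less than the classes of the base, and the class of
b lies outside it. The assumed upper bound leaves no room for anything else. -/
theorem range_sup_span_and_finrank :
    LinearMap.range (PowClass.map p K K₁) ⊔ Submodule.span (ZMod p) {PowClass.mk p h.genUnit} = ⊤ ∧
    Module.finrank (ZMod p) (PowClass p K₁) = Module.finrank (ZMod p) (PowClass p K) := by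
  have : Fact p.Prime := ⟨h.prime⟩
  have h1 := LinearMap.finrank_range_add_finrank_ker (PowClass.map p K K₁)
  rw [h.ker_map, finrank_span_singleton h.mk_baseUnit_ne_zero] at h1
  set R := LinearMap.range (PowClass.map p K K₁)
  have hlt : R < R ⊔ Submodule.span (ZMod p) {PowClass.mk p h.genUnit} := by
    refine lt_of_le_of_ne le_sup_left fun he => h.mk_gen_notMem_range ?_
    change _ ∈ R
    rw [he]
    exact Submodule.mem_sup_right (Submodule.mem_span_singleton_self _)
  have h2 := Submodule.finrank_lt_finrank_of_lt hlt
  have h3 := Submodule.finrank_le (R ⊔ Submodule.span (ZMod p) {PowClass.mk p h.genUnit})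
  exact ⟨Submodule.eq_top_of_finrank_eq (by omega), by omega⟩

theorem finrank_powClass_eq :
    Module.finrank (ZMod p) (PowClass p K₁) = Module.finrank (ZMod p) (PowClass p K) :=
  (h.range_sup_span_and_finrank hle).2

/-- Norms from `K(a ^ (1 / p))` are powers of `a` modulo `p`-th powers. -/
theorem normMap_mem_span (x : PowClass p K₁) :
    normMap p K K₁ x ∈ Submodule.span (ZMod p) {PowClass.mk p h.baseUnit} := by
  have hx : x ∈ (⊤ : Submodule (ZMod p) (PowClass p K₁)) := Submodule.mem_top
  rw [← (h.range_sup_span_and_finrank hle).1] at hx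
  obtain ⟨_, ⟨y, rfl⟩, g, hg, rfl⟩ := Submodule.mem_sup.mp hx
  obtain ⟨c, rfl⟩ := Submodule.mem_span_singleton.mp hg
  rw [map_add, h.normMap_map, zero_add, map_smul, h.normMap_mk_gen]
  exact Submodule.smul_mem _ _ (Submodule.mem_span_singleton_self _)

end finrank

end IsKummerGenerator

/-! ### The absolute value on algebraic extensions of E((t)). -/

section LaurentNorm

open Valuation WithZero

/-- This turns the valuation into a real absolute value, as the spectral norm requires. Only
comparisons of norms matter later, so the choice of embedding is immaterial. -/
instance LaurentSeries.instRankOne (E : Type*) [Field E] :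
    RankOne (Valued.v : Valuation (LaurentSeries E) (WithZero (Multiplicative ℤ))) :=
  have : IsNontrivial (Valued.v : Valuation (LaurentSeries E) (WithZero (Multiplicative ℤ))) := by
    obtain ⟨x, hx⟩ := LaurentSeries.valuation_surjective E (WithZero.exp (-1))
    refine ⟨x, ?_, ?_⟩ <;> rw [hx]
    · exact WithZero.exp_ne_zero
    · decide
  (nonempty_rankOne_iff_mulArchimedean.mpr inferInstance).some

open Valued in
/-- The norm on an algebraic extension of `E((t))` that extends the `t`-adic absolute value. -/
def laurentNorm (E K : Type*) [Field E] [Field K] [Algebra (LaurentSeries E) K] (x : K) : ℝ :=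
  letI := Valued.toNontriviallyNormedField (LaurentSeries E) (WithZero (Multiplicative ℤ))
  spectralNorm (LaurentSeries E) K x

namespace laurentNorm

variable {E K : Type*} [Field E] [Field K] [Algebra (LaurentSeries E) K]

theorem nonneg (x : K) : 0 ≤ laurentNorm E K x :=
  letI := Valued.toNontriviallyNormedField (LaurentSeries E) (WithZero (Multiplicative ℤ))
  spectralNorm_nonneg x

@[simp] theorem apply_zero : laurentNorm E K 0 = 0 :=
  letI := Valued.toNontriviallyNormedField (LaurentSeries E) (WithZero (Multiplicative ℤ))
  spectralNorm_zero

theorem map_algEquiv (σ : K ≃ₐ[LaurentSeries E] K) (x : K) :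
    laurentNorm E K (σ x) = laurentNorm E K x :=
  letI := Valued.toNontriviallyNormedField (LaurentSeries E) (WithZero (Multiplicative ℤ))
  (spectralNorm_eq_of_equiv σ x).symm

theorem map_algebraMap {K₁ : Type*} [Field K₁] [Algebra (LaurentSeries E) K₁] [Algebra K K₁]
    [IsScalarTower (LaurentSeries E) K K₁] (x : K) :
    laurentNorm E K₁ (algebraMap K K₁ x) = laurentNorm E K x :=
  letI := Valued.toNontriviallyNormedField (LaurentSeries E) (WithZero (Multiplicative ℤ))
  (spectralNorm.eq_of_tower x).symm

theorem order_inv (f : LaurentSeries E) : (f⁻¹).order = -f.order := by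
  rcases eq_or_ne f 0 with rfl | hf
  · simp
  · have := HahnSeries.order_mul hf (inv_ne_zero hf)
    rw [mul_inv_cancel₀ hf, HahnSeries.order_one] at this
    omega

theorem algebraMap_le_one_iff {f : LaurentSeries E} (hf : f ≠ 0) :
    laurentNorm E K (algebraMap _ K f) ≤ 1 ↔ 0 ≤ f.order := by
  let := Valued.toNontriviallyNormedField (LaurentSeries E) (WithZero (Multiplicative ℤ))
  have h1 : laurentNorm E K (algebraMap _ K f) = ‖f‖ := spectralNorm_extends f
  rw [h1]
  refine (Valued.toNormedField.norm_le_one_iff (val := LaurentSeries.valued E)).trans ?_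
  have h2 := LaurentSeries.valuation_le_iff_coeff_lt_eq_zero E (D := 0) (f := f)
  rw [neg_zero, WithZero.exp_zero] at h2
  rw [h2]
  constructor
  · intro h
    by_contra! hlt
    exact hf (HahnSeries.coeff_order_eq_zero.mp (h _ hlt))
  · intro h n hn
    exact HahnSeries.coeff_eq_zero_of_lt_order (hn.trans_le h)

variable [Algebra.IsAlgebraic (LaurentSeries E) K]

@[simp] theorem apply_mul (x y : K) :
    laurentNorm E K (x * y) = laurentNorm E K x * laurentNorm E K y :=
  letI := Valued.toNontriviallyNormedField (LaurentSeries E) (WithZero (Multiplicative ℤ))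
  map_mul (spectralMulAlgNorm (LaurentSeries E) K) x y

@[simp] theorem apply_one : laurentNorm E K 1 = 1 :=
  letI := Valued.toNontriviallyNormedField (LaurentSeries E) (WithZero (Multiplicative ℤ))
  map_one (spectralMulAlgNorm (LaurentSeries E) K)

variable (E K) in
/-- `laurentNorm` as a monoid homomorphism. -/
def hom : K →* ℝ where
  toFun := laurentNorm E K
  map_one' := apply_one
  map_mul' := apply_mul

@[simp] theorem apply_pow (x : K) (n : ℕ) : laurentNorm E K (x ^ n) = laurentNorm E K x ^ n :=
  map_pow (hom E K) x n

@[simp] theorem apply_prod {ι : Type*} (s : Finset ι) (f : ι → K) :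
    laurentNorm E K (∏ i ∈ s, f i) = ∏ i ∈ s, laurentNorm E K (f i) :=
  map_prod (hom E K) f s

@[simp] theorem apply_neg (x : K) : laurentNorm E K (-x) = laurentNorm E K x :=
  letI := Valued.toNontriviallyNormedField (LaurentSeries E) (WithZero (Multiplicative ℤ))
  spectralNorm_neg (Algebra.IsAlgebraic.isAlgebraic x)

theorem add_le_max (x y : K) :
    laurentNorm E K (x + y) ≤ max (laurentNorm E K x) (laurentNorm E K y) :=
  letI := Valued.toNontriviallyNormedField (LaurentSeries E) (WithZero (Multiplicative ℤ))
  isNonarchimedean_spectralNorm x y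

theorem sub_le_max (x y : K) :
    laurentNorm E K (x - y) ≤ max (laurentNorm E K x) (laurentNorm E K y) := by
  simpa [sub_eq_add_neg] using add_le_max (E := E) x (-y)

theorem pos {x : K} (hx : x ≠ 0) : 0 < laurentNorm E K x :=
  letI := Valued.toNontriviallyNormedField (LaurentSeries E) (WithZero (Multiplicative ℤ))
  spectralNorm_zero_lt hx (Algebra.IsAlgebraic.isAlgebraic x)

@[simp] theorem apply_inv (x : K) : laurentNorm E K x⁻¹ = (laurentNorm E K x)⁻¹ := by
  rcases eq_or_ne x 0 with rfl | hx
  · simp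
  · refine eq_inv_of_mul_eq_one_left ?_
    rw [← apply_mul (E := E), inv_mul_cancel₀ hx, apply_one]

theorem algebraMap_lt_one_iff {f : LaurentSeries E} (hf : f ≠ 0) :
    laurentNorm E K (algebraMap _ K f) < 1 ↔ 0 < f.order := by
  have h := algebraMap_le_one_iff (K := K) (inv_ne_zero hf)
  have hpos : 0 < laurentNorm E K (algebraMap _ K f) :=
    pos ((map_ne_zero (algebraMap _ K)).mpr hf)
  rw [map_inv₀, apply_inv, order_inv, inv_le_one₀ hpos] at h
  rw [← not_iff_not, not_lt, h]
  omega

theorem algebraMap_eq_one_iff {f : LaurentSeries E} (hf : f ≠ 0) :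
    laurentNorm E K (algebraMap _ K f) = 1 ↔ f.order = 0 := by
  have h1 := algebraMap_le_one_iff (K := K) hf
  have h2 := algebraMap_lt_one_iff (K := K) hf
  rw [eq_iff_le_not_lt, h1, h2]
  omega

/-- The value of a unit of `K`: the order of its norm. -/
def value (E K : Type*) [Field E] [Field K] [Algebra (LaurentSeries E) K] :
    Kˣ →* Multiplicative ℤ :=
  MonoidHom.comp
    { toFun := fun f : (LaurentSeries E)ˣ => Multiplicative.ofAdd (f : LaurentSeries E).order
      map_one' := by simp
      map_mul' := fun f g => by
        rw [Units.val_mul, HahnSeries.order_mul f.ne_zero g.ne_zero, ofAdd_add] }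
    (Units.map (Algebra.norm (LaurentSeries E) : K →* LaurentSeries E))

/-- The field norm of x is, up to sign, a power of the constant coefficient of its minimal
polynomial, while the spectral norm is a root of the absolute value of that coefficient. So `value`
has the elements of norm one as kernel, with an image in ℤ. -/
theorem value_eq_one_iff [FiniteDimensional (LaurentSeries E) K] (x : Kˣ) :
    value E K x = 1 ↔ laurentNorm E K (x : K) = 1 := by
  have hN : Algebra.norm (LaurentSeries E) (x : K) ≠ 0 := Algebra.norm_ne_zero_iff.mpr x.ne_zero
  have h1 : value E K x = 1 ↔ (Algebra.norm (LaurentSeries E) (x : K)).order = 0 := Iff.rfl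
  rw [h1, ← algebraMap_eq_one_iff (K := K) hN]
  have hx : IsIntegral (LaurentSeries E) (x : K) := Algebra.IsIntegral.isIntegral _
  have h2 := Algebra.PowerBasis.norm_gen_eq_coeff_zero_minpoly
    (IntermediateField.adjoin.powerBasis hx)
  rw [IntermediateField.adjoin.powerBasis_gen, IntermediateField.minpoly_gen] at h2
  rw [Algebra.norm_eq_norm_adjoin, h2, map_pow, apply_pow, _root_.map_mul, apply_mul,
    map_pow, apply_pow, _root_.map_neg, apply_neg, _root_.map_one, apply_one, one_pow, one_mul]
  let := Valued.toNontriviallyNormedField (LaurentSeries E) (WithZero (Multiplicative ℤ))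
  have h3 : laurentNorm E K (x : K) = _ :=
    spectralNorm.spectralNorm_eq_norm_coeff_zero_rpow (LaurentSeries E) K (x : K)
  have h4 : laurentNorm E K (algebraMap _ K ((minpoly (LaurentSeries E) (x : K)).coeff 0)) =
    ‖(minpoly (LaurentSeries E) (x : K)).coeff 0‖ := spectralNorm_extends _
  rw [h3, h4, pow_eq_one_iff_of_nonneg (norm_nonneg _) Module.finrank_pos.ne']
  have hd : (1 / ((minpoly (LaurentSeries E) (x : K)).natDegree : ℝ)) ≠ 0 :=
    one_div_ne_zero (Nat.cast_ne_zero.mpr (minpoly.natDegree_pos hx).ne')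
  rw [← Real.rpow_left_inj (norm_nonneg _) zero_le_one hd, Real.one_rpow]

end laurentNorm

end LaurentNorm

/-! ### Elements close to 1 are p-th powers. -/

open Polynomial in
theorem IsKummerGenerator.adjoinRoot {K : Type*} [Field K] {p : ℕ} (hp : p.Prime) {z a : K}
    (hz : IsPrimitiveRoot (z ^ p) p) (ha : ∀ c : K, c ^ p ≠ a) :
    haveI : Fact (Irreducible (X ^ p - C a)) := ⟨X_pow_sub_C_irreducible_of_prime hp ha⟩
    IsKummerGenerator p z a (AdjoinRoot.root (X ^ p - C a)) :=
  haveI : Fact (Irreducible (X ^ p - C a)) := ⟨X_pow_sub_C_irreducible_of_prime hp ha⟩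
  { prime := hp
    primitive := hz
    not_pow := ha
    pow_eq := root_X_pow_sub_C_pow p a
    adjoin_eq_top := IntermediateField.adjoin_eq_top_of_algebra _ _ AdjoinRoot.adjoinRoot_eq_top }

namespace laurentNorm

open Polynomial

variable {E K : Type*} [Field E] [Field K] [Algebra (LaurentSeries E) K]

section

variable [FiniteDimensional (LaurentSeries E) K]

/-- A form of Hensel's lemma obtained from invariance of the norm under conjugation: if x were close
to 1, all conjugates of b would be close to 1, hence to each other, yet b and its conjugate ζb, with
ζ the image of `z ^ p`, are at distance |1 - ζ| = 1. -/
theorem not_lt_one_of_isKummerGenerator {K₁ : Type*} [Field K₁] [Algebra K K₁]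
    [Algebra (LaurentSeries E) K₁] [IsScalarTower (LaurentSeries E) K K₁] {p : ℕ} {z x : K} {b : K₁}
    (h : IsKummerGenerator p z x b) (hz1 : laurentNorm E K (1 - z ^ p) = 1) :
    ¬ laurentNorm E K (x - 1) < 1 := by
  intro hx
  have : FiniteDimensional K K₁ := h.finiteDimensional
  have : FiniteDimensional (LaurentSeries E) K₁ := FiniteDimensional.trans _ K _
  obtain ⟨σ, hσ⟩ := h.exists_algEquiv
  have hprim : IsPrimitiveRoot (algebraMap K K₁ (z ^ p)) p :=
    h.primitive.map_of_injective (algebraMap K K₁).injective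
  have hσi : ∀ i : ℕ, (σ^[i]) b = algebraMap K K₁ (z ^ p) ^ i * b := by
    intro i
    induction i with
    | zero => simp
    | succ i ih =>
      rw [Function.iterate_succ_apply', ih, map_mul, map_pow, AlgEquiv.commutes, hσ, pow_succ]
      ring
  have hinv : ∀ y : K₁, laurentNorm E K₁ (σ y) = laurentNorm E K₁ y :=
    fun y => map_algEquiv (σ.restrictScalars (LaurentSeries E)) y
  have hconj : ∀ i : ℕ, laurentNorm E K₁ (1 - algebraMap K K₁ (z ^ p) ^ i * b) =
      laurentNorm E K₁ (1 - b) := by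
    intro i
    have h1 : 1 - algebraMap K K₁ (z ^ p) ^ i * b = (σ^[i]) (1 - b) := by
      rw [← hσi]
      induction i with
      | zero => rfl
      | succ i ih => rw [Function.iterate_succ_apply', Function.iterate_succ_apply', ← ih, map_sub,
          map_one]
    rw [h1]
    clear h1
    induction i with
    | zero => rfl
    | succ i ih => rw [Function.iterate_succ_apply', hinv, ih]
  -- Evaluating X ^ p - x = ∏ (X - ζ ^ i b) at 1; by `hconj` all factors have the same norm.
  have hprod : ∏ i ∈ Finset.range p, (1 - algebraMap K K₁ (z ^ p) ^ i * b) =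
      algebraMap K K₁ (1 - x) := by
    have h1 := congrArg (Polynomial.eval 1) (X_pow_sub_C_eq_prod hprim h.prime.pos h.pow_eq)
    simp only [eval_sub, eval_pow, eval_X, eval_C, eval_prod, one_pow] at h1
    rw [← h1, map_sub, map_one]
  have hlt : laurentNorm E K₁ (1 - b) < 1 := by
    have h1 := congrArg (laurentNorm E K₁) hprod
    rw [apply_prod, Finset.prod_congr rfl fun i _ => hconj i, Finset.prod_const, Finset.card_range,
      map_algebraMap] at h1
    rw [← neg_sub, apply_neg, ← h1] at hx
    exact (pow_lt_one_iff_of_nonneg (nonneg _) h.prime.ne_zero).mp hx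
  have hx1 : laurentNorm E K x = 1 := by
    have h1 : x = (x - 1) + 1 := by ring
    refine le_antisymm ?_ ?_
    · rw [h1]
      exact (add_le_max _ _).trans (max_le hx.le apply_one.le)
    · by_contra! hlt'
      have h2 := sub_le_max (E := E) x (x - 1)
      rw [sub_sub_cancel, apply_one] at h2
      exact absurd h2 (not_le.mpr (max_lt hlt' hx))
  have hb : laurentNorm E K₁ b = 1 := by
    have h1 := congrArg (laurentNorm E K₁) h.pow_eq
    rw [apply_pow, map_algebraMap, hx1] at h1
    exact (pow_eq_one_iff_of_nonneg (nonneg _) h.prime.ne_zero).mp h1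
  have hdiff : laurentNorm E K₁ (algebraMap K K₁ (1 - z ^ p) * b) < 1 := by
    have h1 : algebraMap K K₁ (1 - z ^ p) * b =
        (1 - algebraMap K K₁ (z ^ p) ^ 1 * b) - (1 - b) := by
      rw [map_sub, map_one]
      ring
    rw [h1]
    refine (sub_le_max _ _).trans_lt (max_lt ?_ hlt)
    rw [hconj]
    exact hlt
  rw [apply_mul, map_algebraMap, hz1, hb, one_mul] at hdiff
  exact lt_irrefl _ hdiff

/-- An element close to `1` is a `p`-th power, for a prime `p` different from the residue
characteristic. -/
theorem exists_pow_eq {p : ℕ} (hp : p.Prime) {z : K} (hz : IsPrimitiveRoot (z ^ p) p)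
    (hz1 : laurentNorm E K (1 - z ^ p) = 1) {x : K} (hx : laurentNorm E K (x - 1) < 1) :
    ∃ y : K, y ^ p = x := by
  by_contra! ha
  have : Fact (Irreducible (X ^ p - C x)) := ⟨X_pow_sub_C_irreducible_of_prime hp ha⟩
  exact not_lt_one_of_isKummerGenerator (IsKummerGenerator.adjoinRoot hp hz ha) hz1 hx

end

/-! ### The residue field is finite over the field of coefficients. -/

section Residue

variable [Algebra.IsAlgebraic (LaurentSeries E) K]

theorem algebraMap_C {c : E} (hc : c ≠ 0) :
    laurentNorm E K (algebraMap (LaurentSeries E) K (HahnSeries.C c)) = 1 := by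
  rw [algebraMap_eq_one_iff (by simpa using hc)]
  exact HahnSeries.order_C

variable (E K) in
/-- The ring of elements of norm at most `1`. -/
def integers : ValuationSubring K where
  carrier := {x | laurentNorm E K x ≤ 1}
  mul_mem' {x y} hx hy := by
    simp only [Set.mem_ofPred_eq, apply_mul] at *
    exact mul_le_one₀ hx (nonneg _) hy
  one_mem' := apply_one.le
  add_mem' {x y} hx hy := (add_le_max x y).trans (max_le hx hy)
  zero_mem' := by simp
  neg_mem' {x} hx := by simpa using hx
  mem_or_inv_mem' x := by
    simp only [Set.mem_ofPred_eq, apply_inv]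
    rcases le_total (laurentNorm E K x) 1 with h | h
    · exact Or.inl h
    · exact Or.inr (inv_le_one_of_one_le₀ h)

theorem mem_integers {x : K} : x ∈ integers E K ↔ laurentNorm E K x ≤ 1 := Iff.rfl

variable (E K) in
/-- The residue field of `K`. -/
abbrev Residue : Type _ := IsLocalRing.ResidueField (integers E K)

theorem residue_eq_zero_iff (x : integers E K) :
    IsLocalRing.residue (integers E K) x = 0 ↔ laurentNorm E K (x : K) < 1 := by
  rw [IsLocalRing.residue_eq_zero_iff, IsLocalRing.mem_maximalIdeal, mem_nonunits_iff]
  constructor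
  · intro h
    by_contra! h1
    have hx : (x : K) ≠ 0 := by
      intro h0
      rw [h0, apply_zero] at h1
      exact absurd h1 (by norm_num)
    refine h (IsUnit.of_mul_eq_one ⟨(x : K)⁻¹, ?_⟩ (Subtype.ext (mul_inv_cancel₀ hx)))
    rw [mem_integers, apply_inv]
    exact inv_le_one_of_one_le₀ h1
  · rintro h ⟨u, rfl⟩
    have h1 : ((u : integers E K) : K) * ((u⁻¹ : (integers E K)ˣ) : integers E K) = 1 := by
      rw [← MulMemClass.coe_mul, Units.mul_inv]; rfl
    have h2 := congrArg (laurentNorm E K) h1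
    rw [apply_mul, apply_one] at h2
    have h3 : laurentNorm E K ((u⁻¹ : (integers E K)ˣ) : integers E K) ≤ 1 :=
      ((u⁻¹ : (integers E K)ˣ) : integers E K).2
    nlinarith [nonneg (E := E) (((u⁻¹ : (integers E K)ˣ) : integers E K) : K),
      nonneg (E := E) ((u : integers E K) : K)]

variable (E K) in
/-- The constants of `E` in the integers of `K`. -/
def constHom : E →+* integers E K :=
  ((algebraMap (LaurentSeries E) K).comp (HahnSeries.C : E →+* LaurentSeries E)).codRestrict _
    fun c => by
      rcases eq_or_ne c 0 with rfl | hc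
      · rw [map_zero]
        exact zero_mem _
      · exact (algebraMap_C hc).le

instance : Algebra E (Residue E K) :=
  ((IsLocalRing.residue (integers E K)).comp (constHom E K)).toAlgebra

theorem algebraMap_residue_def (c : E) : algebraMap E (Residue E K) c =
    IsLocalRing.residue (integers E K) (constHom E K c) := rfl

/-- An integral element of `E((t))` reduces to its constant coefficient. -/
theorem residue_algebraMap {f : LaurentSeries E}
    (hf : algebraMap (LaurentSeries E) K f ∈ integers E K) :
    IsLocalRing.residue (integers E K) ⟨algebraMap (LaurentSeries E) K f, hf⟩ =
      algebraMap E (Residue E K) (f.coeff 0) := by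
  rw [algebraMap_residue_def, ← sub_eq_zero, ← map_sub, residue_eq_zero_iff]
  have h0 : (((⟨algebraMap (LaurentSeries E) K f, hf⟩ - constHom E K (f.coeff 0) :
      integers E K)) : K) = algebraMap (LaurentSeries E) K (f - HahnSeries.C (f.coeff 0)) := by
    rw [map_sub]; rfl
  rw [h0]
  rcases eq_or_ne (f - HahnSeries.C (f.coeff 0)) 0 with h | h
  · rw [h, map_zero, apply_zero]
    exact one_pos
  rw [algebraMap_lt_one_iff h]
  by_contra! hle
  refine h (HahnSeries.coeff_order_eq_zero.mp ?_)
  rcases hle.lt_or_eq with hlt | heq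
  · have hC : (HahnSeries.C (f.coeff 0) : LaurentSeries E).coeff
        (f - HahnSeries.C (f.coeff 0)).order = 0 := HahnSeries.coeff_single_of_ne hlt.ne
    rw [HahnSeries.coeff_sub, hC, sub_zero]
    rcases eq_or_ne f 0 with rfl | hf0
    · simp
    exact HahnSeries.coeff_eq_zero_of_lt_order
      (hlt.trans_le ((algebraMap_le_one_iff (K := K) hf0).mp hf))
  · rw [heq, HahnSeries.coeff_sub, HahnSeries.C_apply, HahnSeries.coeff_single_same, sub_self]

/-- A relation is divided by its coefficient of largest norm; it becomes integral with one
coefficient equal to 1, and so reduces to a nontrivial relation. -/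
theorem linearIndependent_of_residue {ι : Type*} (u : ι → integers E K)
    (hu : LinearIndependent E fun i => (IsLocalRing.residue (integers E K) (u i) : Residue E K)) :
    LinearIndependent (LaurentSeries E) fun i => (u i : K) := by
  classical
  rw [linearIndependent_iff'] at hu ⊢
  intro s g hg
  by_contra! hne
  obtain ⟨i₀, hi₀, hgi₀⟩ := hne
  obtain ⟨j, hj, hmax⟩ := s.exists_max_image
    (fun i => laurentNorm E K (algebraMap (LaurentSeries E) K (g i))) ⟨i₀, hi₀⟩
  have hgj : g j ≠ 0 := by
    intro h0
    have h1 := hmax i₀ hi₀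
    rw [h0, map_zero, apply_zero] at h1
    exact absurd h1 (not_le.mpr (pos ((_root_.map_ne_zero _).mpr hgi₀)))
  have hpos : 0 < laurentNorm E K (algebraMap (LaurentSeries E) K (g j)) :=
    pos ((_root_.map_ne_zero _).mpr hgj)
  -- The value 0 outside s only serves to make every `a i` integral.
  let a : ι → LaurentSeries E := fun i => if i ∈ s then (g j)⁻¹ * g i else 0
  have ha : ∀ i, algebraMap (LaurentSeries E) K (a i) ∈ integers E K := by
    intro i
    by_cases hi : i ∈ s
    · rw [mem_integers]
      simp only [a, if_pos hi, map_mul, map_inv₀, apply_mul, apply_inv]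
      rw [inv_mul_le_iff₀ hpos, mul_one]
      exact hmax i hi
    · simp only [a, if_neg hi, map_zero]
      exact zero_mem _
  have hsum : ∑ i ∈ s, (⟨algebraMap (LaurentSeries E) K (a i), ha i⟩ : integers E K) * u i = 0 := by
    apply Subtype.ext
    have h1 := congrArg (fun y => algebraMap (LaurentSeries E) K (g j)⁻¹ * y) hg
    simp only [mul_zero, Finset.mul_sum] at h1
    rw [AddSubmonoidClass.coe_finsetSum, ← ZeroMemClass.coe_zero (integers E K)] at *
    refine Eq.trans (Finset.sum_congr rfl fun i hi => ?_) h1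
    simp only [a, if_pos hi, MulMemClass.coe_mul, map_mul, Algebra.smul_def, mul_assoc]
  have hred := congrArg (IsLocalRing.residue (integers E K)) hsum
  rw [map_sum, map_zero] at hred
  have h1 := hu s (fun i => (a i).coeff 0) (by
    rw [← hred]
    refine Finset.sum_congr rfl fun i _ => ?_
    rw [map_mul, residue_algebraMap, Algebra.smul_def]) j hj
  simp only [a, if_pos hj, inv_mul_cancel₀ hgj] at h1
  rw [← HahnSeries.single_zero_one, HahnSeries.coeff_single_same] at h1
  exact one_ne_zero h1

instance [FiniteDimensional (LaurentSeries E) K] : FiniteDimensional E (Residue E K) := by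
  let b := Module.Basis.ofVectorSpace E (Residue E K)
  choose u hu using fun i => IsLocalRing.residue_surjective (R := integers E K) (b i)
  have hli : LinearIndependent (LaurentSeries E) fun i => (u i : K) := by
    apply linearIndependent_of_residue
    simp only [hu]
    exact b.linearIndependent
  have := hli.finite
  exact Module.Finite.of_basis b

end Residue

end laurentNorm

/-! ### The bound on the number of power classes. -/

/-- `Kˣ` is covered by at most `N` classes modulo `p`-th powers. -/
def CoveredByPow (p : ℕ) (K : Type*) [Field K] (N : ℕ) : Prop :=
  ∃ f : Fin N → Kˣ, ∀ x : Kˣ, ∃ i, ∃ y : Kˣ, x = f i * y ^ p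

namespace laurentNorm

variable {E K : Type*} [Field E] [Field K] [Algebra (LaurentSeries E) K]
  [FiniteDimensional (LaurentSeries E) K]

theorem isUnit_of_eq_one {x : K} (hx : laurentNorm E K x = 1) :
    IsLocalRing.residue (integers E K) ⟨x, hx.le⟩ ≠ 0 := fun h => by
  rw [residue_eq_zero_iff] at h
  exact absurd hx h.ne

theorem exists_lift (x : (Residue E K)ˣ) : ∃ y : K, ∃ hy : laurentNorm E K y = 1,
    IsLocalRing.residue (integers E K) ⟨y, hy.le⟩ = x := by
  obtain ⟨y, hy⟩ := IsLocalRing.residue_surjective (R := integers E K) (x : Residue E K)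
  have h1 : ¬ laurentNorm E K (y : K) < 1 := fun h => by
    rw [← residue_eq_zero_iff, hy] at h
    exact x.ne_zero h
  exact ⟨y, le_antisymm y.2 (not_lt.mp h1), hy⟩

/-- Write x = u π ^ n with u of norm one. The residue of u is one of N representatives times a p-th
power; after lifting, the remaining quotient is close to 1 and hence a p-th power. The factor p
counts n modulo p. -/
theorem coveredByPow {p : ℕ} (hp : p.Prime) {z : E} (hz : IsPrimitiveRoot (z ^ p) p) {N : ℕ}
    (h : CoveredByPow p (Residue E K) N) : CoveredByPow p K (N * p) := by
  have : NeZero p := ⟨hp.ne_zero⟩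
  obtain ⟨f, hf⟩ := h
  choose e he he' using fun i => exists_lift (f i)
  have he0 : ∀ i, e i ≠ 0 := fun i h0 => by
    have := he i
    rw [h0, apply_zero] at this
    exact zero_ne_one this
  -- The image of `value` is a subgroup of ℤ, hence cyclic; π is a uniformizer.
  obtain ⟨π, hπ⟩ : ∃ π : Kˣ, ∀ x : Kˣ, ∃ n : ℤ, value E K x = value E K π ^ n := by
    obtain ⟨g, hg⟩ := (Subgroup.isCyclic (value E K).range).exists_generator
    obtain ⟨⟨_, π, rfl⟩, hπ⟩ : ∃ g : (value E K).range, ∀ x, x ∈ Subgroup.zpowers g := ⟨g, hg⟩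
    refine ⟨π, fun x => ?_⟩
    obtain ⟨n, hn⟩ := hπ ⟨value E K x, x, rfl⟩
    exact ⟨n, (congrArg Subtype.val hn).symm⟩
  refine ⟨fun i => Units.mk0 (e (finProdFinEquiv.symm i).1) (he0 _) *
    π ^ ((finProdFinEquiv.symm i).2 : ℕ), fun x => ?_⟩
  obtain ⟨n, hn⟩ := hπ x
  have hu : laurentNorm E K ((x * π ^ (-n) : Kˣ) : K) = 1 := by
    rw [← value_eq_one_iff, map_mul, map_zpow, hn, ← zpow_add, add_neg_cancel, zpow_zero]
  set u : K := ((x * π ^ (-n) : Kˣ) : K) with hu_def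
  obtain ⟨i, y, hiy⟩ := hf (Units.mk0 _ (isUnit_of_eq_one hu))
  obtain ⟨y', hy', hyy'⟩ := exists_lift y
  have hy0 : y' ≠ 0 := fun h0 => by
    rw [h0, apply_zero] at hy'
    exact zero_ne_one hy'
  have hval : IsLocalRing.residue (integers E K) (⟨u, hu.le⟩ - ⟨e i, (he i).le⟩ *
      ⟨y', hy'.le⟩ ^ p) = 0 := by
    rw [map_sub, map_mul, map_pow, he', hyy', sub_eq_zero]
    exact congrArg Units.val hiy
  rw [residue_eq_zero_iff] at hval
  change laurentNorm E K (u - e i * y' ^ p) < 1 at hval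
  have hden : e i * y' ^ p ≠ 0 := mul_ne_zero (he0 i) (pow_ne_zero _ hy0)
  have hden1 : laurentNorm E K (e i * y' ^ p) = 1 := by
    rw [apply_mul, apply_pow, he, hy', one_pow, one_mul]
  have hquot : laurentNorm E K (u / (e i * y' ^ p) - 1) < 1 := by
    rw [div_sub_one hden, div_eq_mul_inv, apply_mul, apply_inv, hden1, inv_one, mul_one]
    exact hval
  set z' : K := algebraMap (LaurentSeries E) K (HahnSeries.C z) with hz'
  have hzp : z' ^ p = algebraMap (LaurentSeries E) K (HahnSeries.C (z ^ p)) := by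
    rw [hz', ← map_pow, ← map_pow]
  have hprim : IsPrimitiveRoot (z' ^ p) p := by
    rw [hzp]
    exact hz.map_of_injective (f := (algebraMap (LaurentSeries E) K).comp HahnSeries.C)
      (RingHom.injective _)
  have hz1 : laurentNorm E K (1 - z' ^ p) = 1 := by
    rw [hzp]
    have h1 : (1 : K) - algebraMap (LaurentSeries E) K (HahnSeries.C (z ^ p)) =
        algebraMap (LaurentSeries E) K (HahnSeries.C (1 - z ^ p)) := by
      rw [map_sub, map_sub, map_one, map_one]
    rw [h1]
    exact algebraMap_C (sub_ne_zero.mpr (hz.ne_one hp.one_lt).symm)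
  obtain ⟨w, hw⟩ := exists_pow_eq hp hprim hz1 hquot
  have hw0 : w ≠ 0 := by
    rintro rfl
    rw [zero_pow hp.ne_zero, eq_comm, div_eq_zero_iff] at hw
    exact hw.elim (Units.ne_zero _) hden
  have hmod : 0 ≤ n % p := Int.emod_nonneg _ (by exact_mod_cast hp.ne_zero)
  have hlt : (n % p).toNat < p := by
    have := Int.emod_lt_of_pos n (b := p) (by exact_mod_cast hp.pos)
    omega
  refine ⟨finProdFinEquiv (i, ⟨(n % p).toNat, hlt⟩),
    Units.mk0 y' hy0 * Units.mk0 w hw0 * π ^ (n / p), ?_⟩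
  simp only [Equiv.symm_apply_apply]
  have hx : x = (x * π ^ (-n)) * π ^ n := by rw [mul_assoc, ← zpow_add]; simp
  have hpow : π ^ n = π ^ (n % p).toNat * (π ^ (n / p)) ^ p := by
    rw [← zpow_natCast, ← zpow_natCast, ← zpow_mul, ← zpow_add, Int.toNat_of_nonneg hmod,
      mul_comm (n / (p : ℤ)), Int.emod_add_mul_ediv]
  have hux : x * π ^ (-n) = Units.mk0 (e i) (he0 i) * (Units.mk0 y' hy0 * Units.mk0 w hw0) ^ p := by
    ext
    rw [← hu_def]
    simp only [Units.val_mul, Units.val_pow_eq_pow_val, Units.val_mk0]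
    rw [mul_pow, hw, ← mul_assoc, mul_div_cancel₀ _ hden]
  refine hx.trans ?_
  rw [hux, hpow, mul_pow _ (π ^ (n / (p : ℤ)))]
  exact mul_mul_mul_comm _ _ _ _

end laurentNorm

/-- Each variable contributes one factor p, because the residue field of K is again a finite
extension of the field with one variable fewer. At the bottom K = k is algebraically closed and has
a single class. -/
theorem IteratedLaurent.coveredByPow {k : Type u} [Field k] [IsAlgClosed k] {p : ℕ} (hp : p.Prime)
    {z : k} (hz : IsPrimitiveRoot (z ^ p) p) (n : ℕ) (K : Type w) [Field K]
    [Algebra (IteratedLaurent k n) K] [FiniteDimensional (IteratedLaurent k n) K] :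
    CoveredByPow p K (p ^ n) := by
  induction n generalizing K with
  | zero =>
    refine ⟨fun _ => 1, fun x => ⟨0, ?_⟩⟩
    let : Algebra k K := inferInstanceAs (Algebra (IteratedLaurent k 0) K)
    have : FiniteDimensional k K := inferInstanceAs (FiniteDimensional (IteratedLaurent k 0) K)
    obtain ⟨c, hc⟩ := IsAlgClosed.algebraMap_bijective_of_isIntegral (k := k) (K := K) |>.2 x
    obtain ⟨d, hd⟩ := IsAlgClosed.exists_pow_nat_eq c hp.pos
    have hd0 : algebraMap k K d ≠ 0 := by
      intro h0
      apply x.ne_zero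
      rw [← hc, ← hd, map_pow, h0, zero_pow hp.ne_zero]
    refine ⟨Units.mk0 _ hd0, Units.ext ?_⟩
    simp [← hc, ← hd]
  | succ n ih =>
    let : Algebra (LaurentSeries (IteratedLaurent k n)) K :=
      inferInstanceAs (Algebra (IteratedLaurent k (n + 1)) K)
    have : FiniteDimensional (LaurentSeries (IteratedLaurent k n)) K :=
      inferInstanceAs (FiniteDimensional (IteratedLaurent k (n + 1)) K)
    rw [pow_succ]
    refine laurentNorm.coveredByPow (E := IteratedLaurent k n) hp
      (z := IteratedLaurent.const k n z) ?_ (ih _)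
    rw [← map_pow]
    exact hz.map_of_injective (RingHom.injective _)

theorem CoveredByPow.finite_and_finrank_le {p n : ℕ} [Fact p.Prime] {K : Type*} [Field K]
    (h : CoveredByPow p K (p ^ n)) :
    Module.Finite (ZMod p) (PowClass p K) ∧ Module.finrank (ZMod p) (PowClass p K) ≤ n := by
  obtain ⟨f, hf⟩ := h
  have hs : Function.Surjective fun i => PowClass.mk p (f i) := fun x => by
    obtain ⟨x, rfl⟩ := PowClass.mk_surjective x
    obtain ⟨i, y, rfl⟩ := hf x
    exact ⟨i, by simp [-PowClass.mk_pow]⟩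
  have hfin : Finite (PowClass p K) := Finite.of_surjective _ hs
  have hfin' : Module.Finite (ZMod p) (PowClass p K) := Module.Finite.of_finite
  refine ⟨hfin', ?_⟩
  have h1 := Nat.card_le_card_of_surjective _ hs
  rw [Module.natCard_eq_pow_finrank (K := ZMod p), Nat.card_zmod, Nat.card_fin] at h1
  exact (Nat.pow_le_pow_iff_right (Fact.out : p.Prime).one_lt).mp h1

/-! ### Independence of the variables modulo p-th powers. -/

/-- The leading coefficient of a Laurent series, as a homomorphism on units. -/
def LaurentSeries.leadingCoeffHom (E : Type*) [Field E] : (LaurentSeries E)ˣ →* Eˣ where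
  toFun f := Units.mk0 (f : LaurentSeries E).leadingCoeff
    (HahnSeries.leadingCoeff_eq_zero.not.mpr f.ne_zero)
  map_one' := by ext; simp
  map_mul' f g := by ext; simp [HahnSeries.leadingCoeff_mul]

/-- The class of a constant `p`-th power is trivial. -/
theorem LaurentSeries.mapHom_C_injective (p : ℕ) (E : Type*) [Field E] :
    Function.Injective (PowClass.mapHom (p := p)
      (Units.map (HahnSeries.C : E →+* LaurentSeries E) : Eˣ →* (LaurentSeries E)ˣ)) := by
  refine Function.LeftInverse.injective
    (g := PowClass.mapHom (LaurentSeries.leadingCoeffHom E)) fun x => ?_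
  obtain ⟨x, rfl⟩ := PowClass.mk_surjective x
  rw [PowClass.mapHom_mk, PowClass.mapHom_mk]
  congr 1
  ext
  simp [LaurentSeries.leadingCoeffHom]

namespace IteratedLaurent

variable (k : Type u) [Field k]

theorem var_ne_zero (n : ℕ) (i : Fin n) : var k n i ≠ 0 := by
  induction n with
  | zero => exact i.elim0
  | succ n ih =>
    refine Fin.lastCases ?_ (fun i => ?_) i
    · simp only [var, Fin.snoc_last]
      exact HahnSeries.single_ne_zero (Γ := ℤ) (one_ne_zero (α := IteratedLaurent k n))
    · simp only [var, Fin.snoc_castSucc]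
      exact (map_ne_zero _).mpr (ih i)

/-- The variables as units. -/
def varUnit (n : ℕ) (i : Fin n) : (IteratedLaurent k n)ˣ := Units.mk0 _ (var_ne_zero k n i)

/-- The older variables stay independent because leading coefficients give a left inverse on
classes. The newest one has order 1, whereas a constant times a p-th power has order divisible by p.
-/
theorem linearIndependent_mk_varUnit (p : ℕ) [Fact p.Prime] (n : ℕ) :
    LinearIndependent (ZMod p) fun i => PowClass.mk p (varUnit k n i) := by
  induction n with
  | zero => exact linearIndependent_empty_type
  | succ n ih =>
    set φ := PowClass.mapHom (p := p)
      (Units.map (succHom k n : IteratedLaurent k n →* IteratedLaurent k (n + 1)))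
      with hφ
    have hinj : Function.Injective φ := LaurentSeries.mapHom_C_injective p (IteratedLaurent k n)
    have h1 : (fun i => PowClass.mk p (varUnit k (n + 1) i)) =
        Fin.snoc (α := fun _ => PowClass p (IteratedLaurent k (n + 1)))
          (fun i => φ (PowClass.mk p (varUnit k n i)))
          (PowClass.mk p (varUnit k (n + 1) (Fin.last n))) := by
      funext i
      refine Fin.lastCases ?_ (fun i => ?_) i
      · rw [Fin.snoc_last]
      · rw [Fin.snoc_castSucc, hφ, PowClass.mapHom_mk]
        congr 1
        ext
        simp [varUnit, var]
    rw [h1, linearIndependent_finSnoc]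
    refine ⟨ih.map' φ (LinearMap.ker_eq_bot.mpr hinj), fun hmem => ?_⟩
    have hle : Submodule.span (ZMod p) (Set.range fun i => φ (PowClass.mk p (varUnit k n i))) ≤
        LinearMap.range φ := by
      rw [Submodule.span_le]
      rintro _ ⟨i, rfl⟩
      exact ⟨_, rfl⟩
    obtain ⟨x, hx⟩ := hle hmem
    obtain ⟨c, rfl⟩ := PowClass.mk_surjective x
    rw [hφ, PowClass.mapHom_mk, PowClass.mk_eq_mk] at hx
    obtain ⟨y, hy⟩ := hx
    let f : LaurentSeries (IteratedLaurent k n) := (y : IteratedLaurent k (n + 1))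
    have hf : f ≠ 0 := y.ne_zero
    have h2 : HahnSeries.C (c : IteratedLaurent k n) =
        (HahnSeries.single (1 : ℤ) (1 : IteratedLaurent k n)) * f ^ p := by
      have h2 := congrArg Units.val hy
      simp only [varUnit, var, Fin.snoc_last, Units.val_mul, Units.val_pow_eq_pow_val,
        Units.val_mk0] at h2
      exact h2
    have h3 := congrArg HahnSeries.order h2
    rw [HahnSeries.order_C, HahnSeries.order_mul (HahnSeries.single_ne_zero one_ne_zero)
      (pow_ne_zero _ hf), HahnSeries.order_single one_ne_zero, HahnSeries.order_pow,
      nsmul_eq_mul] at h3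
    have h4 : (p : ℤ) ∣ 1 := ⟨-f.order, by linarith⟩
    have h5 := Int.le_of_dvd one_pos h4
    have hp := (Fact.out : p.Prime).one_lt
    omega

end IteratedLaurent

/-! ### Galois p-extensions with bounded power classes are abelian. -/

/-- A nontrivial Galois `p`-extension contains a Kummer extension of degree `p`. -/
theorem exists_isKummerGenerator {K L : Type*} [Field K] [Field L] [Algebra K L]
    [FiniteDimensional K L] [IsGalois K L] {p : ℕ} (hp : p.Prime) {z : K}
    (hz : IsPrimitiveRoot (z ^ p) p) {m : ℕ} (hm : Nat.card (L ≃ₐ[K] L) = p ^ (m + 1)) :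
    ∃ (M : IntermediateField K L) (a : K) (b : M), IsKummerGenerator p z a b := by
  have : Fact p.Prime := ⟨hp⟩
  obtain ⟨H, hH⟩ := Sylow.exists_subgroup_card_pow_prime (G := L ≃ₐ[K] L) p
    (n := m) (hm ▸ pow_dvd_pow p (Nat.le_succ m))
  have hidx : H.index = p := by
    have h1 := H.card_mul_index
    rw [hH, hm, pow_succ] at h1
    exact Nat.eq_of_mul_eq_mul_left (pow_pos hp.pos m) h1
  -- A subgroup whose index is the smallest prime factor of the group order is normal.
  have : H.Normal := Subgroup.normal_of_index_eq_minFac_card (by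
    rw [hidx, hm, hp.pow_minFac (Nat.succ_ne_zero m)])
  set M := IntermediateField.fixedField H
  have hM : Module.finrank K M = p := by
    have h1 := Module.finrank_mul_finrank K M L
    rw [IntermediateField.finrank_fixedField_eq_card, hH, ← IsGalois.card_aut_eq_finrank K L, hm,
      pow_succ, mul_comm] at h1
    exact Nat.eq_of_mul_eq_mul_left (pow_pos hp.pos m) h1
  have : IsCyclic (M ≃ₐ[K] M) := isCyclic_of_prime_card (p := p) (by
    rw [IsGalois.card_aut_eq_finrank, hM])
  obtain ⟨b, ⟨a, ha⟩, hb⟩ := exists_root_adjoin_eq_top_of_isCyclic K M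
    ⟨z ^ p, by rw [hM]; exact (mem_primitiveRoots hp.pos).mpr hz⟩
  have hirr := irreducible_X_pow_sub_C_of_root_adjoin_eq_top ha.symm hb
  rw [hM] at ha hirr
  exact ⟨M, a, b, hp, hz, pow_ne_of_irreducible_X_pow_sub_C hirr dvd_rfl hp.ne_one, ha.symm, hb⟩

/-- Elements of `L` with some `p ^ m`-th power in the base field. -/
def pRadicals (p : ℕ) (K L : Type*) [Field K] [Field L] [Algebra K L] : Submonoid L where
  carrier := {x | ∃ m : ℕ, ∃ c : K, x ^ p ^ m = algebraMap K L c}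
  one_mem' := ⟨0, 1, by simp⟩
  mul_mem' := by
    rintro x y ⟨m, c, hc⟩ ⟨n, d, hd⟩
    refine ⟨m + n, c ^ p ^ n * d ^ p ^ m, ?_⟩
    rw [mul_pow, pow_add, pow_mul, hc, mul_comm (p ^ m), pow_mul, hd]
    simp

theorem mem_pRadicals_of_pow_mem {p : ℕ} {K L : Type*} [Field K] [Field L] [Algebra K L] {x : L}
    (h : x ^ p ∈ pRadicals p K L) : x ∈ pRadicals p K L := by
  obtain ⟨m, c, hc⟩ := h
  exact ⟨m + 1, c, by rw [pow_succ', pow_mul, hc]⟩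

section

variable {K L : Type*} [Field K] [Field L] [Algebra K L]

/-- The quotient σ x / x is a root of unity of p-power order, and K contains all of these. -/
theorem exists_algebraMap_mul_of_mem_pRadicals {p : ℕ} (hp : p.Prime)
    (hroots : ∀ m : ℕ, ∃ ω : K, IsPrimitiveRoot ω (p ^ m)) {x : L} (hx : x ∈ pRadicals p K L)
    (σ : L ≃ₐ[K] L) : ∃ c : K, σ x = algebraMap K L c * x := by
  rcases eq_or_ne x 0 with rfl | hx0
  · exact ⟨0, by simp⟩
  obtain ⟨m, c, hc⟩ := hx
  obtain ⟨ω, hω⟩ := hroots m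
  have : NeZero (p ^ m) := ⟨(pow_pos hp.pos m).ne'⟩
  have hc0 : algebraMap K L c ≠ 0 := hc ▸ pow_ne_zero _ hx0
  obtain ⟨i, -, hi⟩ := (hω.map_of_injective (algebraMap K L).injective).eq_pow_of_pow_eq_one
    (ξ := σ x / x) (by rw [div_pow, ← map_pow, hc, AlgEquiv.commutes, div_self hc0])
  exact ⟨ω ^ i, by rw [map_pow, hi, div_mul_cancel₀ _ hx0]⟩

theorem algEquiv_comm_of_mem_pRadicals {p : ℕ} (hp : p.Prime)
    (hroots : ∀ m : ℕ, ∃ ω : K, IsPrimitiveRoot ω (p ^ m)) {x : L} (hx : x ∈ pRadicals p K L)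
    (σ τ : L ≃ₐ[K] L) : σ (τ x) = τ (σ x) := by
  obtain ⟨c, hc⟩ := exists_algebraMap_mul_of_mem_pRadicals hp hroots hx σ
  obtain ⟨d, hd⟩ := exists_algebraMap_mul_of_mem_pRadicals hp hroots hx τ
  rw [hc, hd, map_mul, map_mul, hc, hd, AlgEquiv.commutes, AlgEquiv.commutes]
  ring

/-- The intermediate fields `M` with the expected number of power classes, all represented by
radicals over `K`, on which the automorphisms over `K` commute. -/
structure IsRadicalStep (p n : ℕ) (M : IntermediateField K L) : Prop where
  finrank_eq : Module.finrank (ZMod p) (PowClass p M) = n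
  exists_radical : ∀ x : Mˣ, ∃ r : Mˣ, ((r : M) : L) ∈ pRadicals p K L ∧
    PowClass.mk p x = PowClass.mk p r
  comm : ∀ x : M, ∀ σ τ : L ≃ₐ[K] L, σ (τ x) = τ (σ x)

/-- By induction the class of a contains a radical r, so the step is generated by a p-th root of r,
itself a radical. The classes of the new field come from M and this root, so they too are
represented by radicals. -/
theorem IsRadicalStep.succ {p n : ℕ} (hp : p.Prime)
    (hroots : ∀ m : ℕ, ∃ ω : K, IsPrimitiveRoot ω (p ^ m))
    (hfin : ∀ M : IntermediateField K L, Module.Finite (ZMod p) (PowClass p M))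
    (hle : ∀ M : IntermediateField K L, Module.finrank (ZMod p) (PowClass p M) ≤ n)
    {M : IntermediateField K L} (h : IsRadicalStep p n M) {M₁ : IntermediateField M L} {z a : M}
    {b : M₁} (hb : IsKummerGenerator p z a b) :
    IsRadicalStep p n (M₁.restrictScalars K) := by
  have : NeZero p := ⟨hp.ne_zero⟩
  have hpr := hb.prime
  obtain ⟨r, hr, hr'⟩ := h.exists_radical hb.baseUnit
  obtain ⟨y, hy⟩ := PowClass.mk_eq_mk.mp hr'
  have hay : a = r * (y : M) ^ p := congrArg Units.val hy
  -- Since a = r y ^ p, dividing b by y gives a p-th root of the radical r.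
  set g : M₁ := b * algebraMap M M₁ (y : M)⁻¹ with hg_def
  have hbg : b = g * algebraMap M M₁ y := by
    rw [hg_def, mul_assoc, ← map_mul, inv_mul_cancel₀ y.ne_zero, map_one, mul_one]
  have hg : IsKummerGenerator p z (r : M) g :=
    { prime := hb.prime
      primitive := hb.primitive
      not_pow := fun c hc => hb.not_pow (c * y) (by rw [mul_pow, hc, ← hay])
      pow_eq := by
        rw [hg_def, mul_pow, hb.pow_eq, ← map_pow, ← map_mul, hay, mul_assoc, ← mul_pow,
          mul_inv_cancel₀ y.ne_zero, one_pow, mul_one]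
      adjoin_eq_top := by
        rw [eq_top_iff, ← hb.adjoin_eq_top, IntermediateField.adjoin_simple_le_iff, hbg]
        exact mul_mem (IntermediateField.mem_adjoin_simple_self _ _)
          (IntermediateField.algebraMap_mem _ _) }
  have hgrad : (g : L) ∈ pRadicals p K L := by
    apply mem_pRadicals_of_pow_mem
    have : (g : L) ^ p = ((r : M) : L) := congrArg (algebraMap M₁ L) hg.pow_eq
    rw [this]
    exact hr
  have hfin₁ : Module.Finite (ZMod p) (PowClass p M₁) := hfin (M₁.restrictScalars K)
  have hfin₀ := hfin M
  have hle₁ : Module.finrank (ZMod p) (PowClass p M₁) ≤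
      Module.finrank (ZMod p) (PowClass p M) := by
    rw [h.finrank_eq]
    exact hle (M₁.restrictScalars K)
  refine ⟨?_, ?_, ?_⟩
  · rw [← h.finrank_eq]
    exact hg.finrank_powClass_eq hle₁
  · intro (x : M₁ˣ)
    have hx : PowClass.mk p x ∈ (⊤ : Submodule (ZMod p) (PowClass p M₁)) := Submodule.mem_top
    rw [← (hg.range_sup_span_and_finrank hle₁).1] at hx
    obtain ⟨_, ⟨c, rfl⟩, d, hd, hcd⟩ := Submodule.mem_sup.mp hx
    obtain ⟨i, rfl⟩ := Submodule.mem_span_singleton.mp hd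
    obtain ⟨c, rfl⟩ := PowClass.mk_surjective c
    obtain ⟨s, hs, hs'⟩ := h.exists_radical c
    rw [hs', PowClass.mapHom_mk, PowClass.zmod_smul_mk, ← PowClass.mk_mul] at hcd
    exact ⟨_, mul_mem hs (pow_mem hgrad i.val), hcd.symm⟩
  · intro (x : M₁) σ τ
    have hx : x ∈ IntermediateField.adjoin M {g} := by rw [hg.adjoin_eq_top]; trivial
    induction hx using IntermediateField.adjoin_induction with
    | mem x hx =>
      rw [Set.mem_singleton_iff] at hx
      rw [hx]
      exact algEquiv_comm_of_mem_pRadicals hp hroots hgrad σ τ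
    | algebraMap x => exact h.comm x σ τ
    | add x y _ _ hx hy =>
      change σ (τ ((x : L) + y)) = τ (σ ((x : L) + y))
      rw [map_add, map_add, map_add, map_add]
      exact congrArg₂ _ hx hy
    | inv x _ hx =>
      change σ (τ ((x : L)⁻¹)) = τ (σ ((x : L)⁻¹))
      rw [map_inv₀, map_inv₀, map_inv₀, map_inv₀]
      exact congrArg _ hx
    | mul x y _ _ hx hy =>
      change σ (τ ((x : L) * y)) = τ (σ ((x : L) * y))
      rw [map_mul, map_mul, map_mul, map_mul]
      exact congrArg₂ _ hx hy

/-- An intermediate field of largest degree with the property must be L; otherwise the p-group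
fixing it provides one more Kummer step. -/
theorem IsRadicalStep.top [FiniteDimensional K L] [IsGalois K L] {p n : ℕ} (hp : p.Prime)
    (hG : IsPGroup p (L ≃ₐ[K] L))
    (hroots : ∀ m : ℕ, ∃ ω : K, IsPrimitiveRoot ω (p ^ m))
    (hfin : ∀ M : IntermediateField K L, Module.Finite (ZMod p) (PowClass p M))
    (hle : ∀ M : IntermediateField K L, Module.finrank (ZMod p) (PowClass p M) ≤ n)
    (hbot : Module.finrank (ZMod p) (PowClass p (⊥ : IntermediateField K L)) = n) :
    IsRadicalStep p n (⊤ : IntermediateField K L) := by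
  have : Fact p.Prime := ⟨hp⟩
  have h0 : IsRadicalStep p n (⊥ : IntermediateField K L) := by
    refine ⟨hbot, fun x => ⟨x, ?_, rfl⟩, ?_⟩
    · obtain ⟨c, hc⟩ := IntermediateField.mem_bot.mp (x : (⊥ : IntermediateField K L)).2
      exact ⟨0, c, by rw [pow_zero, pow_one, hc]⟩
    · rintro ⟨x, hx⟩ σ τ
      obtain ⟨c, rfl⟩ := IntermediateField.mem_bot.mp hx
      simp
  obtain ⟨M, hM, hmax⟩ := (measure fun M : IntermediateField K L =>
    Module.finrank K L - Module.finrank K M).wf.has_min {M | IsRadicalStep p n M} ⟨_, h0⟩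
  have hM : IsRadicalStep p n M := hM
  obtain rfl | hne := eq_or_ne M ⊤
  · exact hM
  exfalso
  have hG' : IsPGroup p (L ≃ₐ[M] L) :=
    (hG.to_subgroup M.fixingSubgroup).of_equiv (IntermediateField.fixingSubgroupEquiv M)
  obtain ⟨m, hm⟩ := IsPGroup.iff_card.mp hG'
  rcases m with _ | m
  · rw [pow_zero, IsGalois.card_aut_eq_finrank] at hm
    exact hne (IntermediateField.finrank_eq_one_iff_eq_top.mp hm)
  -- A root of order p ^ 2 is taken so that its p-th power is primitive of order p.
  obtain ⟨ω, hω⟩ := hroots 2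
  have hz : IsPrimitiveRoot ((algebraMap K M ω) ^ p) p :=
    (hω.map_of_injective (algebraMap K M).injective).pow (pow_pos hp.pos 2) (sq p)
  obtain ⟨M₁, a, b, hb⟩ := exists_isKummerGenerator hp hz hm
  refine hmax _ (hM.succ hp hroots hfin hle hb) ?_
  have h1 : Module.finrank K M * Module.finrank M M₁ = Module.finrank K M₁ :=
    Module.finrank_mul_finrank K M M₁
  have h2 : Module.finrank K M₁ ≤ Module.finrank K L :=
    Submodule.finrank_le (M₁.restrictScalars K).toSubalgebra.toSubmodule
  rw [hb.finrank_eq] at h1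
  have h3 : 0 < Module.finrank K M := Module.finrank_pos
  have h4 := hp.two_le
  change Module.finrank K L - Module.finrank K M₁ < Module.finrank K L - Module.finrank K M
  have : Module.finrank K M < Module.finrank K M₁ := by nlinarith
  omega

end

/-! ### Symplectic linear algebra. -/

namespace LinearMap.BilinForm

variable {𝔽 : Type*} [Field 𝔽] {V : Type*} [AddCommGroup V] [Module 𝔽 V] [FiniteDimensional 𝔽 V]
  {B : LinearMap.BilinForm 𝔽 V}

theorem hyperbolic_split (hB : B.Nondegenerate) (hA : B.IsAlt) {x y : V} (hxy : B x y = 1) :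
    (B.restrict (B.orthogonal (Submodule.span 𝔽 {x, y}))).Nondegenerate ∧
    Module.finrank 𝔽 (B.orthogonal (Submodule.span 𝔽 {x, y})) + 2 = Module.finrank 𝔽 V := by
  have hyx : B y x = -1 := by rw [← hA.neg_eq, hxy]
  have hdis : Disjoint (Submodule.span 𝔽 {x, y}) (B.orthogonal (Submodule.span 𝔽 {x, y})) := by
    rw [Submodule.disjoint_def]
    intro v hv hv'
    obtain ⟨a, b, rfl⟩ := Submodule.mem_span_pair.mp hv
    have h1 := hv' x (Submodule.mem_span_of_mem (by simp))
    have h2 := hv' y (Submodule.mem_span_of_mem (by simp))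
    rw [map_add, map_smul, map_smul, hA.self_eq_zero, hxy] at h1
    rw [map_add, map_smul, map_smul, hA.self_eq_zero, hyx] at h2
    have hb : b = 0 := by simpa using h1
    have ha : a = 0 := by simpa using h2
    simp [ha, hb]
  have hli : LinearIndependent 𝔽 ![x, y] := by
    rw [LinearIndependent.pair_iff]
    intro a b hab
    have h1 := congrArg (B x) hab
    have h2 := congrArg (B y) hab
    rw [map_add, map_smul, map_smul, hA.self_eq_zero, hxy, map_zero] at h1
    rw [map_add, map_smul, map_smul, hA.self_eq_zero, hyx, map_zero] at h2
    exact ⟨by simpa using h2, by simpa using h1⟩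
  have h2 : Module.finrank 𝔽 (Submodule.span 𝔽 {x, y}) = 2 := by
    have := finrank_span_eq_card hli
    rwa [Matrix.range_cons_cons_empty, Fintype.card_fin] at this
  constructor
  · apply nondegenerate_restrict_of_disjoint_orthogonal _ hA.isRefl
    rw [orthogonal_orthogonal hB hA.isRefl]
    exact hdis.symm
  · rw [finrank_orthogonal hB, h2]
    have := Submodule.finrank_le (Submodule.span 𝔽 {x, y})
    omega

/-- Hyperbolic planes are split off one at a time. -/
theorem exists_symplectic_family (m : ℕ) {V : Type*} [AddCommGroup V] [Module 𝔽 V]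
    [FiniteDimensional 𝔽 V] {B : LinearMap.BilinForm 𝔽 V} (hB : B.Nondegenerate) (hA : B.IsAlt)
    (hV : Module.finrank 𝔽 V = 2 * m) : ∃ l d : Fin m → V,
      (∀ i j, B (l i) (l j) = 0) ∧ ∀ i j, B (l i) (d j) = if i = j then 1 else 0 := by
  induction m generalizing V with
  | zero => exact ⟨Fin.elim0, Fin.elim0, fun i => i.elim0, fun i => i.elim0⟩
  | succ m ih =>
    have : Nontrivial V := Module.nontrivial_of_finrank_pos (R := 𝔽) (by omega)
    obtain ⟨x, hx⟩ := exists_ne (0 : V)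
    obtain ⟨y, hxy⟩ : ∃ y, B x y = 1 := by
      obtain ⟨y, hy⟩ : ∃ y, B x y ≠ 0 := by
        by_contra! h
        exact hx (hB.1 x h)
      exact ⟨(B x y)⁻¹ • y, by rw [map_smul, smul_eq_mul, inv_mul_cancel₀ hy]⟩
    obtain ⟨h1, h2⟩ := hyperbolic_split hB hA hxy
    obtain ⟨l, d, hll, hld⟩ := ih h1 (fun v => hA v) (by omega)
    have hl : ∀ v : B.orthogonal (Submodule.span 𝔽 {x, y}), B x v = 0 := fun v =>
      v.2 x (Submodule.mem_span_of_mem (by simp))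
    have hl' : ∀ v : B.orthogonal (Submodule.span 𝔽 {x, y}), B v x = 0 := fun v => by
      rw [← hA.neg_eq, hl, neg_zero]
    have hly : ∀ v : B.orthogonal (Submodule.span 𝔽 {x, y}), B v y = 0 := fun v => by
      rw [← hA.neg_eq, v.2 y (Submodule.mem_span_of_mem (by simp)), neg_zero]
    refine ⟨Fin.cons x fun i => l i, Fin.cons y fun i => d i, ?_, ?_⟩
    · refine Fin.cases (Fin.cases ?_ fun j => ?_) (fun i => Fin.cases ?_ fun j => ?_)
      · simpa using hA x
      · simpa using hl _
      · simpa using hl' _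
      · simpa using hll i j
    · refine Fin.cases (Fin.cases ?_ fun j => ?_) (fun i => Fin.cases ?_ fun j => ?_)
      · simpa using hxy
      · simpa [(Fin.succ_ne_zero _).symm] using hl _
      · simpa using hly _
      · simpa [Fin.succ_inj] using hld i j

/-- A subspace of dimension less than `m + 1` in a symplectic space of dimension `2 (m + 1)` is
orthogonal to a hyperbolic plane; moreover the orthogonal of the latter has a symplectic basis. -/
theorem exists_hyperbolic_pair (hB : B.Nondegenerate) (hA : B.IsAlt) {m : ℕ}
    (hV : Module.finrank 𝔽 V = 2 * (m + 1)) (U : Submodule 𝔽 V) (hU : Module.finrank 𝔽 U < m + 1) :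
    ∃ (x y : V) (l d : Fin m → V), B x y = 1 ∧ (∀ v ∈ U, B v x = 0 ∧ B v y = 0) ∧
      (∀ i, B (l i) x = 0 ∧ B (l i) y = 0) ∧
      (∀ i j, B (l i) (l j) = 0) ∧ ∀ i j, B (l i) (d j) = if i = j then 1 else 0 := by
  obtain ⟨x, hx, y, hy, hxy⟩ : ∃ x ∈ B.orthogonal U, ∃ y ∈ B.orthogonal U, B x y = 1 := by
    -- Without such a pair the orthogonal of U is isotropic, hence contained in its own orthogonal
    -- U, although its dimension 2 (m + 1) - dim U exceeds dim U.
    by_contra! h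
    have hle : B.orthogonal U ≤ B.orthogonal (B.orthogonal U) := by
      intro y hy x hx

      by_contra hne
      refine h x hx ((B x y)⁻¹ • y) (Submodule.smul_mem _ _ hy) ?_
      rw [map_smul, smul_eq_mul, inv_mul_cancel₀ hne]
    rw [orthogonal_orthogonal hB hA.isRefl] at hle
    have h1 := Submodule.finrank_mono hle
    rw [finrank_orthogonal hB] at h1
    omega
  obtain ⟨h1, h2⟩ := hyperbolic_split hB hA hxy
  obtain ⟨l, d, hll, hld⟩ := exists_symplectic_family m h1 (fun v => hA v) (by omega)
  refine ⟨x, y, fun i => l i, fun i => d i, hxy, fun v hv => ⟨hx v hv, hy v hv⟩, fun i => ?_,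
    hll, hld⟩
  have h3 := (l i).2 x (Submodule.mem_span_of_mem (by simp))
  have h4 := (l i).2 y (Submodule.mem_span_of_mem (by simp))
  exact ⟨by rw [← hA.neg_eq, h3, neg_zero], by rw [← hA.neg_eq, h4, neg_zero]⟩

end LinearMap.BilinForm

/-! ### Modules over symbol algebras. -/

section Operators

variable {K : Type w} [Field K] {W : Type*} [AddCommGroup W] [Module K W] [FiniteDimensional K W]

open Polynomial in
/-- If `T ^ p` is a `p`-th power scalar and `T D = ζ D T`, then `D` permutes the eigenspaces
of `T` transitively, so the dimension of some nonzero eigenspace is at most `dim W / p`. -/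
theorem exists_eigenspace_finrank_le [Nontrivial W] {p : ℕ} (hp : p.Prime) {ζ : K}
    (hζ : IsPrimitiveRoot ζ p) {T D : Module.End K W} {c d : K} (hc : c ≠ 0) (hd : d ≠ 0)
    (hT : T ^ p = (c ^ p) • 1) (hD : D ^ p = d • 1) (hTD : T * D = ζ • (D * T)) :
    ∃ μ : K, Module.End.eigenspace T μ ≠ ⊥ ∧
      p * Module.finrank K (Module.End.eigenspace T μ) ≤ Module.finrank K W := by
  -- X ^ p - c ^ p splits over K, so T has an eigenvalue in K.
  obtain ⟨μ, hμ⟩ : ∃ μ, T.HasEigenvalue μ := by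
    have hdvd : minpoly K T ∣ X ^ p - C (c ^ p) := minpoly.dvd _ _ (by
      rw [map_sub, aeval_X_pow, aeval_C, hT, Algebra.algebraMap_eq_smul_one, sub_self])
    have hspl := (X_pow_sub_C_splits_of_isPrimitiveRoot hζ (α := c) rfl).of_dvd
      (monic_X_pow_sub_C _ hp.ne_zero).ne_zero hdvd
    have hint : IsIntegral K T := Algebra.IsIntegral.isIntegral T
    obtain ⟨μ, hμ⟩ := hspl.exists_eval_eq_zero (minpoly.degree_pos hint).ne'
    exact ⟨μ, Module.End.hasEigenvalue_of_isRoot hμ⟩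
  -- Nonvanishing of μ makes the p eigenvalues ζ ^ i μ distinct.
  have hμ0 : μ ≠ 0 := by
    rintro rfl
    obtain ⟨v, hv⟩ := hμ.exists_hasEigenvector
    have h1 : (T ^ p) v = (0 : K) ^ p • v := hv.pow_apply p
    rw [hT, zero_pow hp.ne_zero, zero_smul, LinearMap.smul_apply, Module.End.one_apply] at h1
    exact (smul_ne_zero (pow_ne_zero p hc) hv.2) h1
  have hDinj : Function.Injective D := by
    intro x y hxy
    have h1 : (D ^ p) x = (D ^ p) y := by
      obtain ⟨q, rfl⟩ := Nat.exists_eq_succ_of_ne_zero hp.ne_zero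
      rw [pow_succ, Module.End.mul_apply, Module.End.mul_apply, hxy]
    rw [hD] at h1
    exact smul_right_injective W hd h1
  refine ⟨μ, hμ, ?_⟩
  let E : Fin p → Submodule K W := fun i => Module.End.eigenspace T (ζ ^ (i : ℕ) * μ)
  have hmap : ∀ (i : ℕ) (v : W), v ∈ Module.End.eigenspace T μ →
      (D ^ i) v ∈ Module.End.eigenspace T (ζ ^ i * μ) := by
    intro i v hv
    induction i with
    | zero => simpa using hv
    | succ i ih =>
      rw [Module.End.mem_eigenspace_iff] at ih ⊢
      have h1 := LinearMap.congr_fun hTD ((D ^ i) v)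
      rw [Module.End.mul_apply, LinearMap.smul_apply, Module.End.mul_apply, ih, map_smul] at h1
      rw [pow_succ', Module.End.mul_apply, h1, smul_smul, pow_succ', mul_assoc]
  have hrank : ∀ i : Fin p, Module.finrank K (Module.End.eigenspace T μ) ≤
      Module.finrank K (E i) := by
    intro i
    let f : Module.End.eigenspace T μ →ₗ[K] E i :=
      ((D ^ (i : ℕ)).comp (Submodule.subtype _)).codRestrict _ fun v => hmap i v v.2
    refine LinearMap.finrank_le_finrank_of_injective (f := f) fun x y hxy => ?_
    have h1 : (D ^ (i : ℕ)) x = (D ^ (i : ℕ)) y := congrArg Subtype.val hxy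
    rw [Module.End.pow_apply, Module.End.pow_apply] at h1
    exact Subtype.ext (hDinj.iterate _ h1)
  have hind : iSupIndep E := by
    refine (Module.End.eigenspaces_iSupIndep T).comp
      (f := fun i : Fin p => ζ ^ (i : ℕ) * μ) fun i j hij => ?_
    exact Fin.ext (hζ.pow_inj i.2 j.2 (mul_right_cancel₀ hμ0 hij))
  have h1 := LinearMap.finrank_le_finrank_of_injective hind.dfinsupp_lsum_injective
  have h2 : Module.finrank K (Π₀ i, E i) = ∑ i, Module.finrank K (E i) :=
    Module.finrank_directSum K fun i => E i
  rw [h2] at h1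
  refine le_trans ?_ h1
  simpa using Finset.card_nsmul_le_sum Finset.univ _ _ fun i _ => hrank i

end Operators

/-- No finite extension of `K` has more `p`-th power classes than `K`. -/
def PowClassBounded (p : ℕ) (K : Type w) [Field K] : Prop :=
  ∀ (K₁ : Type w) [Field K₁] [Algebra K K₁] [FiniteDimensional K K₁],
    Module.Finite (ZMod p) (PowClass p K₁) ∧
      Module.finrank (ZMod p) (PowClass p K₁) ≤ Module.finrank (ZMod p) (PowClass p K)

section Symbol

variable {K K₁ : Type*} [Field K] [Field K₁] [Algebra K K₁] {p : ℕ} {z a : K} {g : K₁}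
  {W : Type*} [AddCommGroup W] [Module K W] [FiniteDimensional K W] [Nontrivial W]

/-- If the symbol algebra `(a, b)` acts on a space of dimension at most `p`, then `b` is a norm
from `K(a ^ (1 / p))` up to a `p`-th power. -/
theorem IsKummerGenerator.exists_mk_eq_normMap (h : IsKummerGenerator p z a g)
    (hW : Module.finrank K W ≤ p) {A B : Module.End K W} {b : Kˣ} (hA : A ^ p = a • 1)
    (hB : B ^ p = (b : K) • 1) (hAB : A * B = z ^ p • (B * A)) :
    ∃ x, PowClass.mk p b = IsKummerGenerator.normMap p K K₁ x := by
  have := h.finiteDimensional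
  have : NeZero p := ⟨h.prime.ne_zero⟩
  obtain ⟨σ, hσ⟩ := h.exists_algEquiv
  have hroot : Polynomial.aeval A (minpoly K h.powerBasis.gen) = 0 := by
    rw [h.powerBasis_gen, h.minpoly_eq, map_sub, Polynomial.aeval_X_pow, Polynomial.aeval_C, hA,
      Algebra.algebraMap_eq_smul_one, sub_self]
  -- Letting g act as A makes W a vector space over K₁, of dimension one since dim_K W ≤ p.
  let φ : K₁ →ₐ[K] Module.End K W := h.powerBasis.lift A hroot
  have hφg : φ g = A := by
    have h1 := h.powerBasis.lift_gen A hroot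
    rwa [h.powerBasis_gen] at h1
  -- The relation A B = z ^ p B A says that B is semilinear for the inverse of σ.
  have hcomm : ∀ f : K₁, B * φ (σ f) = φ f * B := by
    have h1 : (LinearMap.mulLeft K B).comp (φ.toLinearMap.comp σ.toLinearMap) =
        (LinearMap.mulRight K B).comp φ.toLinearMap := by
      refine h.powerBasis.basis.ext fun i => ?_
      have h2 : SemiconjBy B (φ (σ g)) (φ g) := by
        rw [SemiconjBy, hσ, map_mul, AlgHom.commutes, hφg, hAB, Algebra.algebraMap_eq_smul_one,
          smul_mul_assoc, one_mul, mul_smul_comm]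
      simpa [h.powerBasis.basis_eq_pow] using (h2.pow_right i).eq
    exact fun f => LinearMap.congr_fun h1 f
  obtain ⟨w, hw⟩ := exists_ne (0 : W)
  let ev : K₁ →ₗ[K] W := (LinearMap.applyₗ w).comp φ.toLinearMap
  have hev : ∀ f, ev f = φ f w := fun f => rfl
  have hinj : Function.Injective ev := by
    rw [injective_iff_map_eq_zero]
    intro f hf
    by_contra hf0
    apply hw
    have h1 : φ (f⁻¹ * f) w = 0 := by
      rw [map_mul, Module.End.mul_apply, ← hev f, hf, map_zero]
    rwa [inv_mul_cancel₀ hf0, map_one, Module.End.one_apply] at h1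
  have hdim : Module.finrank K K₁ = Module.finrank K W :=
    le_antisymm (LinearMap.finrank_le_finrank_of_injective hinj) (by rwa [h.finrank_eq])
  obtain ⟨f, hf⟩ := (LinearMap.injective_iff_surjective_of_finrank_eq_finrank hdim).mp hinj (B w)
  rw [hev] at hf
  -- With B w = f w, the vector B ^ n w is a product of n conjugates of f applied to w; only the
  -- norm of this product is needed.
  have key : ∀ n : ℕ, ∃ F : K₁, (B ^ n) w = φ F w ∧
      Algebra.norm K F = Algebra.norm K f ^ n := by
    intro n
    induction n with
    | zero => exact ⟨1, by simp⟩
    | succ n ih =>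
      obtain ⟨F, hF, hN⟩ := ih
      refine ⟨σ.symm F * f, ?_, ?_⟩
      · have h1 := LinearMap.congr_fun (hcomm (σ.symm F)) w
        rw [AlgEquiv.apply_symm_apply, Module.End.mul_apply, Module.End.mul_apply] at h1
        rw [pow_succ', Module.End.mul_apply, hF, h1, map_mul, Module.End.mul_apply, hf]
      · rw [map_mul, Algebra.norm_eq_of_algEquiv, hN, pow_succ]
  obtain ⟨F, hF, hN⟩ := key p
  have hFb : F = algebraMap K K₁ b := by
    apply hinj
    rw [hev, hev, ← hF, hB, AlgHom.commutes, Algebra.algebraMap_eq_smul_one]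
  rw [hFb, Algebra.norm_algebraMap, h.finrank_eq] at hN
  have hf0 : f ≠ 0 := by
    rintro rfl
    rw [Algebra.norm_zero, zero_pow h.prime.ne_zero] at hN
    exact pow_ne_zero p b.ne_zero hN
  have hNf : Algebra.norm K f ≠ 0 := Algebra.norm_ne_zero_iff.mpr hf0
  -- Taking norms of B ^ p w = b w gives b ^ p = N(f) ^ p, so b = N(f) up to a root of unity, which
  -- is a p-th power by the form `z ^ p`.
  obtain ⟨i, -, hi⟩ := h.primitive.eq_pow_of_pow_eq_one (ξ := (b : K) / Algebra.norm K f)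
    (by rw [div_pow, hN, div_self (pow_ne_zero _ hNf)])
  refine ⟨PowClass.mk p (Units.mk0 f hf0), ?_⟩
  rw [PowClass.mapHom_mk, PowClass.mk_eq_mk]
  have hz0 : z ≠ 0 := by
    rintro rfl
    exact h.primitive.ne_zero h.prime.ne_zero (zero_pow h.prime.ne_zero)
  refine ⟨Units.mk0 z hz0 ^ i, Units.ext ?_⟩
  simp only [Units.val_mul, Units.val_pow_eq_pow_val, Units.val_mk0, Units.coe_map]
  rw [← pow_mul, mul_comm i, pow_mul, hi, mul_div_cancel₀ _ hNf]

end Symbol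

section SymbolDim

variable {K : Type w} [Field K] {p : ℕ} {z : K}

/-- A symbol algebra `(a, b)` with `a` and `b` independent modulo `p`-th powers has no nonzero
module of dimension at most `p`. -/
theorem lt_finrank_of_symbol (hp : p.Prime) (hz : IsPrimitiveRoot (z ^ p) p)
    (hK : PowClassBounded p K) {W : Type*} [AddCommGroup W] [Module K W] [FiniteDimensional K W]
    [Nontrivial W] {A B : Module.End K W} {a b : Kˣ} (ha : PowClass.mk p a ≠ 0)
    (hab : PowClass.mk p b ∉ Submodule.span (ZMod p) {PowClass.mk p a})
    (hA : A ^ p = (a : K) • 1) (hB : B ^ p = (b : K) • 1) (hAB : A * B = z ^ p • (B * A)) :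
    p < Module.finrank K W := by
  by_contra! hW
  have ha' : ∀ c : K, c ^ p ≠ a := fun c hc => ha ((PowClass.mk_eq_zero' hp.ne_zero).mpr ⟨c, hc⟩)
  have hg := IsKummerGenerator.adjoinRoot hp hz ha'
  have : Fact (Irreducible (Polynomial.X ^ p - Polynomial.C (a : K))) :=
    ⟨X_pow_sub_C_irreducible_of_prime hp ha'⟩
  have := hg.finiteDimensional
  obtain ⟨x, hx⟩ := hg.exists_mk_eq_normMap hW hA hB hAB
  have h0 := (hK K).1
  obtain ⟨h1, h2⟩ := hK (AdjoinRoot (Polynomial.X ^ p - Polynomial.C (a : K)))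
  apply hab
  -- Being a norm, b would be a power of a modulo p-th powers.
  rw [hx]
  have h3 := hg.normMap_mem_span h2 x
  have h4 : hg.baseUnit = a := Units.ext rfl
  rwa [h4] at h3

/-- A tensor product of `m` split symbol algebras and of a symbol algebra `(a, b)` with `a` and `b`
independent has no nonzero module of dimension at most `p ^ (m + 1)`. -/
theorem pow_lt_finrank_of_symbols (hp : p.Prime) (hz : IsPrimitiveRoot (z ^ p) p)
    (hK : PowClassBounded p K) {a b : Kˣ} (ha : PowClass.mk p a ≠ 0)
    (hab : PowClass.mk p b ∉ Submodule.span (ZMod p) {PowClass.mk p a}) (m : ℕ)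
    {W : Type*} [AddCommGroup W] [Module K W] [FiniteDimensional K W] [Nontrivial W]
    (A B : Module.End K W) (T D : Fin m → Module.End K W)
    (hA : A ^ p = (a : K) • 1) (hB : B ^ p = (b : K) • 1) (hAB : A * B = z ^ p • (B * A))
    (hT : ∀ i, ∃ c : K, c ≠ 0 ∧ T i ^ p = c ^ p • 1) (hD : ∀ i, ∃ c : K, c ≠ 0 ∧ D i ^ p = c • 1)
    (hTA : ∀ i, Commute (T i) A) (hTB : ∀ i, Commute (T i) B) (hTT : ∀ i j, Commute (T i) (T j))
    (hTD : ∀ i, T i * D i = z ^ p • (D i * T i)) (hTD' : ∀ i j, i ≠ j → Commute (T i) (D j)) :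
    p ^ (m + 1) < Module.finrank K W := by
  induction m generalizing W with
  | zero => simpa using lt_finrank_of_symbol hp hz hK ha hab hA hB hAB
  | succ m ih =>
    obtain ⟨c, hc, hTc⟩ := hT 0
    obtain ⟨d, hd, hDd⟩ := hD 0
    -- Everything commuting with `T 0` acts on this eigenspace, whose dimension is smaller by a
    -- factor p; only `D 0` is lost.
    obtain ⟨μ, hμ, hle⟩ := exists_eigenspace_finrank_le hp hz hc hd hTc hDd (hTD 0)
    set E := Module.End.eigenspace (T 0) μ
    have : Nontrivial E := Submodule.nontrivial_iff_ne_bot.mpr hμ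
    have hst : ∀ {S : Module.End K W}, Commute (T 0) S → ∀ v ∈ E, S v ∈ E := by
      intro S hS v hv
      rw [Module.End.mem_eigenspace_iff] at hv ⊢
      have h1 := LinearMap.congr_fun hS.eq v
      rw [Module.End.mul_apply, Module.End.mul_apply, hv, map_smul] at h1
      exact h1
    have hpow : ∀ {S : Module.End K W} (hS : Commute (T 0) S) {c : K}, S ^ p = c • 1 →
        (S.restrict (hst hS)) ^ p = c • 1 := by
      intro S hS c hc
      ext v
      have h1 : ((S ^ p) v : W) = c • (v : W) := by rw [hc]; rfl
      rw [Module.End.pow_restrict]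
      exact h1
    have hmul : ∀ {S S' : Module.End K W} (hS : Commute (T 0) S) (hS' : Commute (T 0) S') {c : K},
        S * S' = c • (S' * S) → S.restrict (hst hS) * S'.restrict (hst hS') =
          c • (S'.restrict (hst hS') * S.restrict (hst hS)) := by
      intro S S' hS hS' c hc
      ext v
      exact LinearMap.congr_fun hc v
    have hcm : ∀ {S S' : Module.End K W} (hS : Commute (T 0) S) (hS' : Commute (T 0) S'),
        Commute S S' → Commute (S.restrict (hst hS)) (S'.restrict (hst hS')) := by
      intro S S' hS hS' hc
      have h1 := hmul hS hS' (c := 1) (by rw [one_smul]; exact hc.eq)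
      rwa [one_smul] at h1
    have hTs : ∀ i : Fin m, Commute (T 0) (T i.succ) := fun i => hTT _ _
    have hDs : ∀ i : Fin m, Commute (T 0) (D i.succ) := fun i => hTD' _ _ (Fin.succ_ne_zero i).symm
    have h1 := ih (A.restrict (hst (hTA 0))) (B.restrict (hst (hTB 0)))
      (fun i => (T i.succ).restrict (hst (hTs i))) (fun i => (D i.succ).restrict (hst (hDs i)))
      (hpow (hTA 0) hA) (hpow (hTB 0) hB) (hmul (hTA 0) (hTB 0) hAB)
      (fun i => (hT i.succ).imp fun c hc => ⟨hc.1, hpow (hTs i) hc.2⟩)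
      (fun i => (hD i.succ).imp fun c hc => ⟨hc.1, hpow (hDs i) hc.2⟩)
      (fun i => hcm (hTs i) (hTA 0) (hTA _)) (fun i => hcm (hTs i) (hTB 0) (hTB _))
      (fun i j => hcm (hTs i) (hTs j) (hTT _ _)) (fun i => hmul (hTs i) (hDs i) (hTD _))
      (fun i j hij => hcm (hTs i) (hDs j) (hTD' _ _ (by simpa using hij)))
    calc p ^ (m + 1 + 1) = p * p ^ (m + 1) := pow_succ' _ _
      _ < p * Module.finrank K E := Nat.mul_lt_mul_of_pos_left h1 hp.pos
      _ ≤ _ := hle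

end SymbolDim

theorem PowClassBounded.of_finrank_eq {p : ℕ} {K : Type w} [Field K] (hK : PowClassBounded p K)
    {K' : Type w} [Field K'] [Algebra K K'] [FiniteDimensional K K']
    (h : Module.finrank (ZMod p) (PowClass p K') = Module.finrank (ZMod p) (PowClass p K)) :
    PowClassBounded p K' := by
  intro K₁ _ _ _
  let : Algebra K K₁ := ((algebraMap K' K₁).comp (algebraMap K K')).toAlgebra
  have : IsScalarTower K K' K₁ := IsScalarTower.of_algebraMap_eq fun _ => rfl
  have : FiniteDimensional K K₁ := FiniteDimensional.trans K K' K₁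
  rw [h]
  exact hK K₁

/-- Finitely many `p`-th power classes can be killed by a finite extension, and this kills nothing
more than their span. -/
theorem PowClassBounded.exists_ker_map_eq_span {p : ℕ} (hp : p.Prime) (m : ℕ) {K : Type w}
    [Field K] {z : K} (hz : IsPrimitiveRoot (z ^ p) p) (hK : PowClassBounded p K)
    (a : Fin m → PowClass p K) :
    ∃ (K' : Type w) (_ : Field K') (_ : Algebra K K'), PowClassBounded p K' ∧
      LinearMap.ker (PowClass.map p K K') = Submodule.span (ZMod p) (Set.range a) := by
  induction m generalizing K with
  | zero =>
    refine ⟨K, inferInstance, inferInstance, hK, ?_⟩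
    rw [Set.range_eq_empty, Submodule.span_empty, LinearMap.ker_eq_bot']
    intro x hx
    obtain ⟨x, rfl⟩ := PowClass.mk_surjective x
    exact hx
  | succ m ih =>
    have hspan : Submodule.span (ZMod p) (Set.range a) =
        Submodule.span (ZMod p) {a 0} ⊔ Submodule.span (ZMod p) (Set.range (Fin.tail a)) := by
      rw [← Submodule.span_insert, ← Fin.range_cons, Fin.cons_self_tail]
    rw [hspan]
    by_cases ha : a 0 = 0
    · rw [ha, Submodule.span_zero_singleton, bot_sup_eq]
      exact ih hz hK _
    obtain ⟨c, hc⟩ := PowClass.mk_surjective (a 0)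
    rw [← hc] at ha
    have hc' : ∀ d : K, d ^ p ≠ c := fun d hd => ha ((PowClass.mk_eq_zero' hp.ne_zero).mpr ⟨d, hd⟩)
    have : Fact (Irreducible (Polynomial.X ^ p - Polynomial.C (c : K))) :=
      ⟨X_pow_sub_C_irreducible_of_prime hp hc'⟩
    have hg := IsKummerGenerator.adjoinRoot hp hz hc'
    have := hg.finiteDimensional
    let K₁ := AdjoinRoot (Polynomial.X ^ p - Polynomial.C (c : K))
    have h0 := (hK K).1
    obtain ⟨h1, h2⟩ := hK K₁
    have hK₁ : PowClassBounded p K₁ := hK.of_finrank_eq (hg.finrank_powClass_eq h2)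
    have hz₁ : IsPrimitiveRoot (algebraMap K K₁ z ^ p) p := by
      rw [← map_pow]
      exact hz.map_of_injective (algebraMap K K₁).injective
    -- The first step preserves the number of classes, so the bound persists and the images of the
    -- remaining classes can be killed over K₁.
    obtain ⟨K', _, _, hK', hker⟩ := ih hz₁ hK₁ fun i => PowClass.map p K K₁ (Fin.tail a i)
    let : Algebra K K' := ((algebraMap K₁ K').comp (algebraMap K K₁)).toAlgebra
    have : IsScalarTower K K₁ K' := IsScalarTower.of_algebraMap_eq fun _ => rfl
    refine ⟨K', inferInstance, inferInstance, hK', ?_⟩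
    have hcomp : PowClass.map p K K' = (PowClass.map p K₁ K').comp (PowClass.map p K K₁) :=
      LinearMap.ext fun x => (PowClass.map_map K₁ K' x).symm
    have hb : hg.baseUnit = c := Units.ext rfl
    rw [hcomp, LinearMap.ker_comp, hker, Set.range_comp', Submodule.span_image,
      Submodule.comap_map_eq, hg.ker_map, hb, hc, sup_comm]

/-! ### Monomials in q-commuting generators. -/

/-- If `S` and `T` commute up to a scalar `c`, then `(S T) ^ n` is `S ^ n T ^ n` up to a power
of `c`. -/
theorem exists_mul_pow_eq_smul {K A : Type*} [Field K] [Ring A] [Algebra K A] {S T : A} {c : K}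
    (h : T * S = c • (S * T)) (n : ℕ) : ∃ i : ℕ, (S * T) ^ n = c ^ i • (S ^ n * T ^ n) := by
  have hpow : ∀ n : ℕ, T ^ n * S = c ^ n • (S * T ^ n) := by
    intro n
    induction n with
    | zero => simp
    | succ n ih =>
      rw [pow_succ', mul_assoc, ih, mul_smul_comm, ← mul_assoc, h, smul_mul_assoc, smul_smul,
        mul_assoc, ← pow_succ]
  induction n with
  | zero => exact ⟨0, by simp⟩
  | succ n ih =>
    obtain ⟨i, hi⟩ := ih
    refine ⟨i + n, ?_⟩
    rw [pow_succ, hi, smul_mul_assoc, mul_assoc, ← mul_assoc (T ^ n), hpow, smul_mul_assoc,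
      mul_smul_comm, smul_smul, ← pow_add, pow_succ, pow_succ, mul_assoc, mul_assoc]

/-- The products of the `g i`, together with the number of occurrences of each `g i` modulo `p`. -/
inductive IsMonomial {ι A : Type*} [DecidableEq ι] [Monoid A] (p : ℕ) (g : ι → A) :
    (ι → ZMod p) → A → Prop
  | one : IsMonomial p g 0 1
  | mul (i : ι) (v : ι → ZMod p) (T : A) : IsMonomial p g v T →
      IsMonomial p g (Pi.single i 1 + v) (g i * T)

namespace IsMonomial

variable {ι : Type*} [DecidableEq ι] {p : ℕ}

theorem mul' {A : Type*} [Monoid A] {g : ι → A} {v v' : ι → ZMod p} {T T' : A}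
    (h : IsMonomial p g v T) (h' : IsMonomial p g v' T') : IsMonomial p g (v + v') (T * T') := by
  induction h with
  | one => simpa using h'
  | mul i v T _ ih =>
    rw [add_assoc, mul_assoc]
    exact mul i _ _ ih

theorem exists_of [Fintype ι] [NeZero p] {A : Type*} [Monoid A] (g : ι → A) (v : ι → ZMod p) :
    ∃ T, IsMonomial p g v T := by
  have h1 : ∀ (i : ι) (n : ℕ), ∃ T, IsMonomial p g (n • Pi.single i 1) T := by
    intro i n
    induction n with
    | zero => exact ⟨1, by simpa using one⟩
    | succ n ih =>
      obtain ⟨T, hT⟩ := ih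
      refine ⟨g i * T, ?_⟩
      rw [succ_nsmul']
      exact mul i _ _ hT
  rw [← Finset.univ_sum_single v]
  refine Finset.sum_induction _ (fun v => ∃ T, IsMonomial p g v T)
    (fun v v' ⟨T, hT⟩ ⟨T', hT'⟩ => ⟨_, hT.mul' hT'⟩) ⟨1, one⟩ fun i _ => ?_
  have h2 : Pi.single i (v i) = (v i).val • Pi.single (M := fun _ => ZMod p) i 1 := by
    rw [← Pi.single_smul, nsmul_one, ZMod.natCast_zmod_val]
  rw [h2]
  exact h1 i _

variable {K A : Type*} [Field K] [Ring A] [Algebra K A] {g : ι → A}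
  {B : LinearMap.BilinForm (ZMod p) (ι → ZMod p)} {χ : AddChar (ZMod p) K}
  (hg : ∀ i j, g i * g j = χ (B (Pi.single i 1) (Pi.single j 1)) • (g j * g i))
include hg

theorem gen_mul_eq {v : ι → ZMod p} {T : A} (h : IsMonomial p g v T) (j : ι) :
    g j * T = χ (B (Pi.single j 1) v) • (T * g j) := by
  induction h with
  | one => simp
  | mul i v T _ ih =>
    rw [← mul_assoc, hg, smul_mul_assoc, mul_assoc, ih, mul_smul_comm, smul_smul, mul_assoc,
      map_add, AddChar.map_add_eq_mul]

theorem mul_eq {v v' : ι → ZMod p} {T T' : A} (h : IsMonomial p g v T)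
    (h' : IsMonomial p g v' T') : T * T' = χ (B v v') • (T' * T) := by
  induction h with
  | one => simp
  | mul i v T _ ih =>
    rw [mul_assoc, ih, mul_smul_comm, ← mul_assoc, h'.gen_mul_eq hg, smul_mul_assoc, smul_smul,
      mul_assoc, map_add, LinearMap.add_apply, AddChar.map_add_eq_mul, mul_comm (χ _)]

/-- The scalars produced by reordering are powers of `z ^ p`, hence p-th powers. So the class of the
p-th power is additive in the exponent vector although the generators do not commute. -/
theorem exists_pow_eq [Fact p.Prime] {z : K} (hχ : ∀ i, ∃ n : ℕ, χ i = (z ^ p) ^ n) (hz : z ≠ 0)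
    {a : ι → Kˣ} (ha : ∀ i, g i ^ p = (a i : K) • 1)
    {q : (ι → ZMod p) →ₗ[ZMod p] PowClass p K} (hq : ∀ i, q (Pi.single i 1) = PowClass.mk p (a i))
    {v : ι → ZMod p} {T : A} (h : IsMonomial p g v T) :
    ∃ c : Kˣ, T ^ p = (c : K) • 1 ∧ PowClass.mk p c = q v := by
  induction h with
  | one => exact ⟨1, by simp⟩
  | mul i v T h ih =>
    obtain ⟨c, hc, hc'⟩ := ih
    have h1 : T * g i = χ (-B (Pi.single i 1) v) • (g i * T) := by
      rw [h.gen_mul_eq hg, smul_smul, ← AddChar.map_add_eq_mul, neg_add_cancel,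
        AddChar.map_zero_eq_one, one_smul]
    obtain ⟨m, hm⟩ := exists_mul_pow_eq_smul h1 p
    obtain ⟨n, hn⟩ := hχ (-B (Pi.single i 1) v)
    refine ⟨(Units.mk0 z hz ^ (n * m)) ^ p * (a i * c), ?_, ?_⟩
    · rw [hm, hn, ha, hc, smul_mul_assoc, one_mul, smul_smul, smul_smul]
      congr 1
      simp only [Units.val_mul, Units.val_pow_eq_pow_val, Units.val_mk0]
      ring
    · rw [PowClass.mk_mul, PowClass.mk_pow_self, zero_add, PowClass.mk_mul, hc', map_add, hq]

end IsMonomial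

/-! ### At least r classes die when r symbols split. -/

section Rank

variable {K : Type w} [Field K] {p : ℕ} {z : K} {ι : Type*} [Fintype ι] [DecidableEq ι]

/-- If a tensor product of `r` symbol algebras has a nonzero module of dimension at most `p ^ r`,
then at least `r` independent classes become `p`-th powers. -/
theorem le_finrank_ker_of_symbols (hp : p.Prime) (hz : IsPrimitiveRoot (z ^ p) p)
    (hK : PowClassBounded p K) {r : ℕ} (hr : 0 < r) {W : Type*} [AddCommGroup W] [Module K W]
    [FiniteDimensional K W] [Nontrivial W] (hW : Module.finrank K W ≤ p ^ r)
    (hι : Fintype.card ι = 2 * r) {B : LinearMap.BilinForm (ZMod p) (ι → ZMod p)}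
    (hB : B.Nondegenerate) (hA : B.IsAlt) {g : ι → Module.End K W} {a : ι → Kˣ}
    (hg : ∀ i j, g i * g j =
      (z ^ p) ^ (B (Pi.single i 1) (Pi.single j 1)).val • (g j * g i))
    (ha : ∀ i, g i ^ p = (a i : K) • 1)
    {q : (ι → ZMod p) →ₗ[ZMod p] PowClass p K}
    (hq : ∀ i, q (Pi.single i 1) = PowClass.mk p (a i)) :
    r ≤ Module.finrank (ZMod p) (LinearMap.ker q) := by
  have : Fact p.Prime := ⟨hp⟩
  obtain ⟨m, rfl⟩ := Nat.exists_eq_succ_of_ne_zero hr.ne'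
  by_contra! hlt
  have hV : Module.finrank (ZMod p) (ι → ZMod p) = 2 * (m + 1) := by
    rw [Module.finrank_fintype_fun_eq_card, hι]
  obtain ⟨x, y, l, d, hxy, hU, hlxy, hll, hld⟩ :=
    LinearMap.BilinForm.exists_hyperbolic_pair hB hA hV _ hlt
  -- Killing exactly the classes of the isotropic vectors `l i` splits the m symbols attached to the
  -- pairs (`l i`, `d i`).
  obtain ⟨K', _, _, hK', hker⟩ := hK.exists_ker_map_eq_span hp m hz fun i => q (l i)
  set z' := algebraMap K K' z with hz'_def
  have hz' : IsPrimitiveRoot (z' ^ p) p := by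
    rw [← map_pow]
    exact hz.map_of_injective (algebraMap K K').injective
  have hz0 : z' ≠ 0 := by
    intro h0
    rw [h0, zero_pow hp.ne_zero] at hz'
    exact hz'.ne_zero hp.ne_zero rfl
  let χ := AddChar.zmodChar p hz'.pow_eq_one
  have hχ : ∀ i, χ i = (z' ^ p) ^ i.val := AddChar.zmodChar_apply _
  let W' := K' ⊗[K] W
  let β : Module.End K W →ₐ[K] Module.End K' W' := Module.End.baseChangeHom K K' W
  let g' : ι → Module.End K' W' := fun i => β (g i)
  let a' : ι → K'ˣ := fun i => Units.map (algebraMap K K' : K →* K') (a i)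
  let q' := (PowClass.map p K K').comp q
  have hq' : ∀ i, q' (Pi.single i 1) = PowClass.mk p (a' i) := fun i => by
    change PowClass.map p K K' (q _) = _
    rw [hq, PowClass.mapHom_mk]
  have hβ : ∀ (c : K) (T : Module.End K W), β (c • T) = algebraMap K K' c • β T := fun c T => by
    rw [map_smul, algebraMap_smul]
  have hg' : ∀ i j, g' i * g' j = χ (B (Pi.single i 1) (Pi.single j 1)) • (g' j * g' i) := by
    intro i j
    rw [← map_mul, hg, hβ, map_mul, hχ, map_pow, map_pow]
  have ha' : ∀ i, g' i ^ p = (a' i : K') • 1 := by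
    intro i
    rw [← map_pow, ha, hβ, map_one]
    rfl
  have hχ' : ∀ i, ∃ n : ℕ, χ i = (z' ^ p) ^ n := fun i => ⟨_, hχ i⟩
  -- The kernel of q' is ker q + span l, and both summands are orthogonal to x and y.
  have hkerle : ∀ v, q' v = 0 → B v x = 0 ∧ B v y = 0 := by
    intro v hv
    have h1 : q v ∈ Submodule.map q (Submodule.span (ZMod p) (Set.range l)) := by
      rw [← Submodule.span_image, ← Set.range_comp', ← hker]
      exact hv
    obtain ⟨u, hu, huv⟩ := h1
    have h2 : B u x = 0 ∧ B u y = 0 := by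
      clear huv
      induction hu using Submodule.span_induction with
      | mem u hu =>
        obtain ⟨i, rfl⟩ := hu
        exact hlxy i
      | zero => simp
      | add u u' _ _ hu hu' => simp [hu, hu']
      | smul c u _ hu => simp [hu]
    have h3 := hU (v - u) (by rw [LinearMap.mem_ker, map_sub, huv, sub_self])
    rw [map_sub, LinearMap.sub_apply, LinearMap.sub_apply, h2.1, h2.2, sub_zero, sub_zero] at h3
    exact h3
  choose T hT using fun v => IsMonomial.exists_of (p := p) g' v
  have hTpow : ∀ v, ∃ c : K'ˣ, T v ^ p = (c : K') • 1 ∧ PowClass.mk p c = q' v :=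
    fun v => IsMonomial.exists_pow_eq (A := Module.End K' W') hg' hχ' hz0 ha' hq' (hT v)
  have hTc : ∀ v v', B v v' = 0 → Commute (T v) (T v') := by
    intro v v' h
    have h1 := IsMonomial.mul_eq (A := Module.End K' W') hg' (hT v) (hT v')
    rwa [h, AddChar.map_zero_eq_one, one_smul] at h1
  have hT1 : ∀ v v', B v v' = 1 → T v * T v' = z' ^ p • (T v' * T v) := by
    intro v v' h
    have := Fact.mk hp.one_lt
    rw [IsMonomial.mul_eq (A := Module.End K' W') hg' (hT v) (hT v'), h, hχ, ZMod.val_one, pow_one]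
  obtain ⟨a, haT, haq⟩ := hTpow x
  obtain ⟨b, hbT, hbq⟩ := hTpow y
  -- The two omitted hypotheses on a and b, the independence of q'(x) and q'(y), follow from
  -- `hkerle` because B x y = 1.
  have key := pow_lt_finrank_of_symbols hp hz' hK' (a := a) (b := b) ?_ ?_ m (T x) (T y)
    (fun i => T (l i)) (fun i => T (d i)) haT hbT (hT1 _ _ hxy) ?_ ?_
    (fun i => hTc _ _ (hlxy i).1) (fun i => hTc _ _ (hlxy i).2) (fun i j => hTc _ _ (hll i j))
    (fun i => hT1 _ _ (by rw [hld, if_pos rfl])) (fun i j hij => hTc _ _ (by rw [hld, if_neg hij]))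
  · rw [Module.finrank_baseChange] at key
    exact absurd hW (not_le.mpr key)
  · intro h0
    rw [haq] at h0
    have := (hkerle x h0).2
    rw [hxy] at this
    exact one_ne_zero this
  · intro hmem
    obtain ⟨c, hc⟩ := Submodule.mem_span_singleton.mp hmem
    have h0 : q' (y - c • x) = 0 := by
      rw [map_sub, map_smul, ← haq, ← hbq, hc, sub_self]
    have h1 := (hkerle _ h0).1
    rw [map_sub, map_smul, LinearMap.sub_apply, LinearMap.smul_apply, hA.self_eq_zero, smul_zero,
      sub_zero, ← hA.neg_eq, hxy] at h1
    exact one_ne_zero (neg_eq_zero.mp h1)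
  · intro i
    obtain ⟨c, hc, hcq⟩ := hTpow (l i)
    have h0 : q' (l i) = 0 := by
      have : q (l i) ∈ LinearMap.ker (PowClass.map p K K') := by
        rw [hker]
        exact Submodule.subset_span ⟨i, rfl⟩
      exact this
    obtain ⟨e, he⟩ := PowClass.mk_eq_zero.mp (hcq.trans h0)
    exact ⟨e, e.ne_zero, by rw [hc, ← he, Units.val_pow_eq_pow_val]⟩
  · intro i
    obtain ⟨c, hc, -⟩ := hTpow (d i)
    exact ⟨c, c.ne_zero, hc⟩

end Rank

/-! ### Dimension bounds for symbol algebras and their tensor products. -/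

namespace SymbolAlgebra

variable {F : Type u} [Field F] (p : ℕ) (ζ a b : F)

/-- The quotient map from the free algebra on two generators to the symbol algebra. -/
def ofFree : FreeAlgebra F (Fin 2) →ₐ[F] SymbolAlgebra p ζ a b :=
  RingQuot.mkAlgHom F (Rel p ζ a b)

theorem ofFree_surjective : Function.Surjective (ofFree p ζ a b) :=
  RingQuot.mkAlgHom_surjective F _

/-- The first generator of the symbol algebra. -/
def genX : SymbolAlgebra p ζ a b := ofFree p ζ a b (FreeAlgebra.ι F 0)

/-- The second generator of the symbol algebra. -/
def genY : SymbolAlgebra p ζ a b := ofFree p ζ a b (FreeAlgebra.ι F 1)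

theorem genX_pow : genX p ζ a b ^ p = algebraMap F _ a := by
  have h : ofFree p ζ a b _ = ofFree p ζ a b _ := RingQuot.mkAlgHom_rel F Rel.pow_x
  rwa [map_pow, AlgHom.commutes] at h

theorem genY_pow : genY p ζ a b ^ p = algebraMap F _ b := by
  have h : ofFree p ζ a b _ = ofFree p ζ a b _ := RingQuot.mkAlgHom_rel F Rel.pow_y
  rwa [map_pow, AlgHom.commutes] at h

theorem genX_mul_genY : genX p ζ a b * genY p ζ a b = ζ • (genY p ζ a b * genX p ζ a b) := by
  have h : ofFree p ζ a b _ = ofFree p ζ a b _ := RingQuot.mkAlgHom_rel F Rel.comm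
  rwa [map_mul, map_smul, map_mul] at h

theorem genX_mul_genY_pow (j : ℕ) :
    genX p ζ a b * genY p ζ a b ^ j = ζ ^ j • (genY p ζ a b ^ j * genX p ζ a b) := by
  induction j with
  | zero => simp
  | succ j ih =>
    rw [pow_succ, ← mul_assoc, ih, smul_mul_assoc, mul_assoc, genX_mul_genY, mul_smul_comm,
      smul_smul, ← pow_succ, mul_assoc]

/-- The standard spanning family of the symbol algebra. -/
def standard (ij : Fin p × Fin p) : SymbolAlgebra p ζ a b :=
  genY p ζ a b ^ (ij.1 : ℕ) * genX p ζ a b ^ (ij.2 : ℕ)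

variable {p}

theorem pow_mul_pow_mem_span (hp : 0 < p) (j i : ℕ) : genY p ζ a b ^ j * genX p ζ a b ^ i ∈
    Submodule.span F (Set.range (standard p ζ a b)) := by
  have h1 : genY p ζ a b ^ j * genX p ζ a b ^ i = (a ^ (i / p) * b ^ (j / p)) •
      standard p ζ a b (⟨j % p, Nat.mod_lt _ hp⟩, ⟨i % p, Nat.mod_lt _ hp⟩) := by
    conv_lhs => rw [← Nat.div_add_mod j p, ← Nat.div_add_mod i p]
    rw [pow_add, pow_add, pow_mul, pow_mul, genX_pow, genY_pow, ← map_pow, ← map_pow]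
    simp only [Algebra.algebraMap_eq_smul_one, smul_mul_assoc, one_mul, mul_smul_comm, smul_smul]
    rfl
  rw [h1]
  exact Submodule.smul_mem _ _ (Submodule.subset_span ⟨_, rfl⟩)

/-- The span contains 1 and is stable under left multiplication by both generators. -/
theorem span_standard (hp : 0 < p) : Submodule.span F (Set.range (standard p ζ a b)) = ⊤ := by
  rw [eq_top_iff]
  set M := Submodule.span F (Set.range (standard p ζ a b))
  have key : ∀ f : FreeAlgebra F (Fin 2), ∀ m ∈ M, ofFree p ζ a b f * m ∈ M := by
    intro f
    induction f using FreeAlgebra.induction with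
    | grade0 c =>
      intro m hm
      rw [AlgHom.commutes, ← Algebra.smul_def]
      exact M.smul_mem c hm
    | grade1 i =>
      intro m hm
      induction hm using Submodule.span_induction with
      | mem m hm =>
        obtain ⟨⟨j, l⟩, rfl⟩ := hm
        fin_cases i
        · change genX p ζ a b * (_ * _) ∈ M
          rw [← mul_assoc, genX_mul_genY_pow, smul_mul_assoc, mul_assoc, ← pow_succ']
          exact M.smul_mem _ (pow_mul_pow_mem_span ζ a b hp _ _)
        · change genY p ζ a b * (_ * _) ∈ M
          rw [← mul_assoc, ← pow_succ']
          exact pow_mul_pow_mem_span ζ a b hp _ _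
      | zero => rw [mul_zero]; exact M.zero_mem
      | add m m' _ _ hm hm' => rw [mul_add]; exact M.add_mem hm hm'
      | smul c m _ hm => rw [mul_smul_comm]; exact M.smul_mem _ hm
    | mul f g hf hg =>
      intro m hm
      rw [map_mul, mul_assoc]
      exact hf _ (hg _ hm)
    | add f g hf hg =>
      intro m hm
      rw [map_add, add_mul]
      exact M.add_mem (hf _ hm) (hg _ hm)
  intro x _
  obtain ⟨f, rfl⟩ := ofFree_surjective p ζ a b x
  have h1 : (1 : SymbolAlgebra p ζ a b) ∈ M := by
    simpa using pow_mul_pow_mem_span ζ a b hp 0 0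
  simpa using key f 1 h1

/-- An upper bound suffices: it serves only to bound the size of the splitting matrices. -/
theorem finrank_le (hp : 0 < p) : Module.finrank F (SymbolAlgebra p ζ a b) ≤ p ^ 2 := by
  rw [← finrank_top, ← span_standard ζ a b hp]
  refine (finrank_range_le_card _).trans ?_
  simp [sq]

theorem finite (hp : 0 < p) : Module.Finite F (SymbolAlgebra p ζ a b) :=
  ⟨⟨(Set.finite_range (standard p ζ a b)).toFinset, by
    rw [Set.Finite.coe_toFinset, span_standard ζ a b hp]⟩⟩

end SymbolAlgebra

theorem PiTensorProduct.finrank_eq_prod {F ι : Type*} [Field F] [Fintype ι] (A : ι → Type*)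
    [∀ i, AddCommGroup (A i)] [∀ i, Module F (A i)] [∀ i, Module.Finite F (A i)] :
    Module.finrank F (⨂[F] i, A i) = ∏ i, Module.finrank F (A i) := by
  classical
  rw [Module.finrank_eq_card_basis (Basis.piTensorProduct fun i => Module.finBasis F (A i))]
  simp

/-! ### The symplectic form recording the commutators. -/

section Standard

/-- The standard alternating form on `𝔽ʳ ⊕ 𝔽ʳ`. -/
def standardSymplectic (𝔽 : Type*) [CommRing 𝔽] (r : ℕ) :
    LinearMap.BilinForm 𝔽 (Fin r ⊕ Fin r → 𝔽) :=
  LinearMap.mk₂ 𝔽 (fun v w => ∑ i, (v (Sum.inl i) * w (Sum.inr i) - v (Sum.inr i) * w (Sum.inl i)))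
    (fun v v' w => by rw [← Finset.sum_add_distrib]; congr; ext; simp; ring)
    (fun c v w => by rw [smul_eq_mul, Finset.mul_sum]; congr; ext; simp; ring)
    (fun v w w' => by rw [← Finset.sum_add_distrib]; congr; ext; simp; ring)
    (fun c v w => by rw [smul_eq_mul, Finset.mul_sum]; congr; ext; simp; ring)

variable {𝔽 : Type*} [CommRing 𝔽] {r : ℕ}

theorem standardSymplectic_apply (v w : Fin r ⊕ Fin r → 𝔽) : standardSymplectic 𝔽 r v w =
    ∑ i, (v (Sum.inl i) * w (Sum.inr i) - v (Sum.inr i) * w (Sum.inl i)) := rfl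

theorem standardSymplectic_isAlt : (standardSymplectic 𝔽 r).IsAlt := fun v => by
  rw [standardSymplectic_apply]
  exact Finset.sum_eq_zero fun i _ => by ring

@[simp] theorem standardSymplectic_inl (i : Fin r) (v : Fin r ⊕ Fin r → 𝔽) :
    standardSymplectic 𝔽 r (Pi.single (Sum.inl i) 1) v = v (Sum.inr i) := by
  simp [standardSymplectic_apply, Pi.single_apply]

@[simp] theorem standardSymplectic_inr (i : Fin r) (v : Fin r ⊕ Fin r → 𝔽) :
    standardSymplectic 𝔽 r (Pi.single (Sum.inr i) 1) v = -v (Sum.inl i) := by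
  simp [standardSymplectic_apply, Pi.single_apply]

end Standard

theorem standardSymplectic_nondegenerate {𝔽 : Type*} [Field 𝔽] {r : ℕ} :
    (standardSymplectic 𝔽 r).Nondegenerate := by
  have h : LinearMap.IsRefl (standardSymplectic 𝔽 r) :=
    fun v w h => standardSymplectic_isAlt.isRefl v w h
  refine h.nondegenerate_iff_separatingRight.mpr ?_
  intro v hv
  ext i
  rcases i with i | i
  · simpa using hv (Pi.single (Sum.inr i) 1)
  · simpa using hv (Pi.single (Sum.inl i) 1)

/-! ### The splitting hypothesis translated into operators. -/

section Split

variable {k : Type u} [Field k]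

/-- The variables of `k((t₁))…((t₂ᵣ))`, the odd ones first. -/
def IteratedLaurent.pairUnit (k : Type u) [Field k] (r : ℕ) :
    Fin r ⊕ Fin r → (IteratedLaurent k (2 * r))ˣ :=
  Sum.elim (fun i => varUnit k (2 * r) ⟨2 * i.val, by have := i.isLt; omega⟩)
    (fun i => varUnit k (2 * r) ⟨2 * i.val + 1, by have := i.isLt; omega⟩)

theorem IteratedLaurent.linearIndependent_mk_pairUnit (p : ℕ) [Fact p.Prime] (r : ℕ) :
    LinearIndependent (ZMod p) fun i => PowClass.mk p (pairUnit k r i) := by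
  let e : Fin r ⊕ Fin r → Fin (2 * r) :=
    Sum.elim (fun i => ⟨2 * i.val, by have := i.isLt; omega⟩)
      (fun i => ⟨2 * i.val + 1, by have := i.isLt; omega⟩)
  have he : Function.Injective e := by
    rintro (i | i) (j | j) h
    · have h := congrArg Fin.val h
      change 2 * i.val = 2 * j.val at h
      exact congrArg _ (Fin.ext (by omega))
    · have h := congrArg Fin.val h
      change 2 * i.val = 2 * j.val + 1 at h
      omega
    · have h := congrArg Fin.val h
      change 2 * i.val + 1 = 2 * j.val at h
      omega
    · have h := congrArg Fin.val h
      change 2 * i.val + 1 = 2 * j.val + 1 at h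
      exact congrArg _ (Fin.ext (by omega))
  have h1 := (linearIndependent_mk_varUnit k p (2 * r)).comp e he
  convert h1 using 1
  ext i
  rcases i with i | i <;> rfl

variable (p : ℕ) (ζ : k) (r : ℕ)

/-- The standard generators of the tensor product of symbol algebras. -/
def SymbolTensor.gen : Fin r ⊕ Fin r → SymbolTensor k p ζ r :=
  Sum.elim (fun i => PiTensorProduct.singleAlgHom i (SymbolAlgebra.genX _ _ _ _))
    (fun i => PiTensorProduct.singleAlgHom i (SymbolAlgebra.genY _ _ _ _))

theorem SymbolTensor.gen_pow (i : Fin r ⊕ Fin r) : SymbolTensor.gen p ζ r i ^ p =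
    algebraMap _ _ (IteratedLaurent.pairUnit k r i : IteratedLaurent k (2 * r)) := by
  rcases i with i | i
  · change (PiTensorProduct.singleAlgHom i _) ^ p = _
    rw [← map_pow, SymbolAlgebra.genX_pow, AlgHom.commutes]
    rfl
  · change (PiTensorProduct.singleAlgHom i _) ^ p = _
    rw [← map_pow, SymbolAlgebra.genY_pow, AlgHom.commutes]
    rfl

theorem PiTensorProduct.commute_singleAlgHom {F ι : Type*} [CommRing F] [DecidableEq ι]
    {A : ι → Type*} [∀ i, Ring (A i)] [∀ i, Algebra F (A i)] {i j : ι} (hij : i ≠ j) (x : A i)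
    (y : A j) : Commute (singleAlgHom (R := F) i x) (singleAlgHom (R := F) j y) :=
  Commute.tprod (Pi.mulSingle_commute hij x y)

theorem SymbolTensor.gen_mul_gen [Fact p.Prime] (hζ : ζ ^ p = 1) (i j : Fin r ⊕ Fin r) :
    SymbolTensor.gen p ζ r i * SymbolTensor.gen p ζ r j =
      IteratedLaurent.const k (2 * r) ζ ^
        (standardSymplectic (ZMod p) r (Pi.single i 1) (Pi.single j 1)).val •
      (SymbolTensor.gen p ζ r j * SymbolTensor.gen p ζ r i) := by
  have hc : IteratedLaurent.const k (2 * r) ζ ^ p = 1 := by rw [← map_pow, hζ, map_one]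
  have := Fact.mk (Fact.out : p.Prime).one_lt
  rcases i with i | i <;> rcases j with j | j
  · simp only [standardSymplectic_inl, Pi.single_apply, reduceCtorEq, if_false, ZMod.val_zero,
      pow_zero, one_smul]
    obtain rfl | hij := eq_or_ne i j
    · rfl
    · exact PiTensorProduct.commute_singleAlgHom hij _ _
  · simp only [standardSymplectic_inl, Pi.single_apply, Sum.inr.injEq]
    obtain rfl | hij := eq_or_ne i j
    · simp only [if_true, ZMod.val_one, pow_one]
      change PiTensorProduct.singleAlgHom i _ * PiTensorProduct.singleAlgHom i _ = _
      rw [← map_mul, SymbolAlgebra.genX_mul_genY, map_smul, map_mul]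
      rfl
    · rw [if_neg hij, ZMod.val_zero, pow_zero, one_smul]
      exact PiTensorProduct.commute_singleAlgHom hij _ _
  · simp only [standardSymplectic_inr, Pi.single_apply, Sum.inl.injEq]
    obtain rfl | hij := eq_or_ne i j
    · rw [if_pos rfl]
      have h1 : SymbolTensor.gen p ζ r (Sum.inl i) * SymbolTensor.gen p ζ r (Sum.inr i) =
          IteratedLaurent.const k (2 * r) ζ •
            (SymbolTensor.gen p ζ r (Sum.inr i) * SymbolTensor.gen p ζ r (Sum.inl i)) := by
        change PiTensorProduct.singleAlgHom i _ * PiTensorProduct.singleAlgHom i _ = _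
        rw [← map_mul, SymbolAlgebra.genX_mul_genY, map_smul, map_mul]
        rfl
      -- The form takes the value -1 here, represented by p - 1; combined with the single ζ from x y
      -- = ζ y x this gives ζ ^ p = 1.
      have h2 : (-1 : ZMod p).val + 1 = p := by
        obtain ⟨m, rfl⟩ := Nat.exists_eq_succ_of_ne_zero (Fact.out : p.Prime).ne_zero
        rw [ZMod.val_neg_one]
      rw [h1, smul_smul, ← pow_succ, h2, hc, one_smul]
    · rw [if_neg hij, neg_zero, ZMod.val_zero, pow_zero, one_smul]
      exact PiTensorProduct.commute_singleAlgHom hij _ _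
  · simp only [standardSymplectic_inr, Pi.single_apply, reduceCtorEq, if_false, ZMod.val_zero,
      pow_zero, one_smul, neg_zero]
    obtain rfl | hij := eq_or_ne i j
    · rfl
    · exact PiTensorProduct.commute_singleAlgHom hij _ _

theorem SymbolTensor.finrank_le (hp : 0 < p) :
    Module.finrank (IteratedLaurent k (2 * r)) (SymbolTensor k p ζ r) ≤ (p ^ r) ^ 2 := by
  have : ∀ i : Fin r, Module.Finite (IteratedLaurent k (2 * r))
      (SymbolAlgebra p (IteratedLaurent.const k (2 * r) ζ)
        (IteratedLaurent.var k (2 * r) ⟨2 * i.val, by have := i.isLt; omega⟩)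
        (IteratedLaurent.var k (2 * r) ⟨2 * i.val + 1, by have := i.isLt; omega⟩)) :=
    fun i => SymbolAlgebra.finite _ _ _ hp
  rw [PiTensorProduct.finrank_eq_prod]
  refine (Finset.prod_le_prod' fun i _ => SymbolAlgebra.finrank_le _ _ _ hp).trans ?_
  simp [← pow_mul, mul_comm]

/-- If `L` splits the tensor product of `r` symbol algebras, then at least `r` independent classes
of monomials in the variables become `p`-th powers in `L`. -/
theorem le_finrank_ker_of_isSplitBy [Fact p.Prime] {z : k} (hz : IsPrimitiveRoot (z ^ p) p)
    (hr : 0 < r) {L : Type w} [Field L] [Algebra (IteratedLaurent k (2 * r)) L]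
    (hL : PowClassBounded p L)
    (hsplit : IsSplitBy (IteratedLaurent k (2 * r)) (SymbolTensor k p (z ^ p) r) L)
    (q : (Fin r ⊕ Fin r → ZMod p) →ₗ[ZMod p] PowClass p L)
    (hq : ∀ i, q (Pi.single i 1) = PowClass.map p (IteratedLaurent k (2 * r)) L
      (PowClass.mk p (IteratedLaurent.pairUnit k r i))) :
    r ≤ Module.finrank (ZMod p) (LinearMap.ker q) := by
  have hp : p.Prime := Fact.out
  obtain ⟨n, hn, ⟨e⟩⟩ := hsplit
  set F := IteratedLaurent k (2 * r)
  set D := SymbolTensor k p (z ^ p) r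
  have hfin := e.toLinearEquiv.finrank_eq
  rw [Module.finrank_baseChange, Module.finrank_matrix, Module.finrank_self, mul_one,
    Fintype.card_fin, ← sq] at hfin
  -- Comparing dimensions, n ^ 2 = dim D ≤ (p ^ r) ^ 2.
  have hnr : n ≤ p ^ r :=
    (Nat.pow_le_pow_iff_left two_ne_zero).mp (hfin ▸ SymbolTensor.finrank_le p (z ^ p) r hp.pos)
  have : Nonempty (Fin n) := ⟨⟨0, hn⟩⟩
  let φ : L ⊗[F] D →ₐ[L] Module.End L (Fin n → L) :=
    (Matrix.toLinAlgEquiv'.toAlgHom).comp e.toAlgHom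
  let ρ : D →+* Module.End L (Fin n → L) :=
    φ.toRingHom.comp (Algebra.TensorProduct.includeRight : D →ₐ[F] L ⊗[F] D).toRingHom
  have hρ : ∀ c : F, ρ (algebraMap F D c) = algebraMap F L c • 1 := by
    intro c
    change φ (Algebra.TensorProduct.includeRight (R := F) (algebraMap F D c)) = _
    rw [AlgHom.commutes, IsScalarTower.algebraMap_apply F L (L ⊗[F] D), AlgHom.commutes,
      Algebra.algebraMap_eq_smul_one]
  have hρs : ∀ (c : F) (d : D), ρ (c • d) = algebraMap F L c • ρ d := by
    intro c d
    rw [Algebra.smul_def, map_mul, hρ, smul_mul_assoc, one_mul]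
  let κ : k →+* L := (algebraMap F L).comp (IteratedLaurent.const k (2 * r))
  refine le_finrank_ker_of_symbols (z := κ z) (W := Fin n → L)
    (g := fun i => ρ (SymbolTensor.gen p (z ^ p) r i))
    (a := fun i => Units.map (algebraMap F L : F →* L) (IteratedLaurent.pairUnit k r i)) hp ?_ hL hr
    (by simpa using hnr) (by simp [two_mul]) standardSymplectic_nondegenerate
    standardSymplectic_isAlt ?_ ?_ hq
  · rw [← map_pow]
    exact hz.map_of_injective κ.injective
  · intro i j
    rw [← map_mul, SymbolTensor.gen_mul_gen p (z ^ p) r hz.pow_eq_one, hρs, map_mul, map_pow,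
      ← map_pow κ]
    rfl
  · intro i
    rw [← map_pow, SymbolTensor.gen_pow, hρ]
    rfl

end Split

/-! ### Elementary abelian subgroups of finite abelian groups. -/

section Groups

theorem hasElementaryAbelianSubgroup_of_injective {p s : ℕ} {G : Type u} [Group G]
    (f : Multiplicative (Fin s → ZMod p) →* G) (hf : Function.Injective f) :
    HasElementaryAbelianSubgroup p G s :=
  ⟨f.range, ⟨(MonoidHom.ofInjective hf).symm⟩⟩

theorem exists_injective_of_le_card {p r : ℕ} [Fact p.Prime] {V : Type*} [AddCommGroup V]
    [Module (ZMod p) V] [Finite V] (h : p ^ r ≤ Nat.card V) :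
    ∃ f : (Fin r → ZMod p) →+ V, Function.Injective f := by
  have : Module.Finite (ZMod p) V := Module.Finite.of_finite
  rw [Module.natCard_eq_pow_finrank (K := ZMod p), Nat.card_zmod] at h
  obtain ⟨b, hb⟩ := exists_linearIndependent_of_le_finrank
    ((Nat.pow_le_pow_iff_right (Fact.out : p.Prime).one_lt).mp h)
  exact ⟨(Fintype.linearCombination (ZMod p) b).toAddMonoidHom,
    linearIndependent_iff_injective_fintypeLinearCombination.mp hb⟩

/-- A finite commutative group with at least `p ^ r` classes modulo `p`-th powers contains
`(ℤ / p) ^ r`. -/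
theorem exists_injective_of_le_card_quotient {p r : ℕ} [Fact p.Prime] {G : Type*} [CommGroup G]
    [Finite G] (h : p ^ r ≤ Nat.card (G ⧸ (powMonoidHom p : G →* G).range)) :
    ∃ f : Multiplicative (Fin r → ZMod p) →* G, Function.Injective f := by
  set T := (powMonoidHom p : G →* G).ker
  -- Kernel and cokernel of an endomorphism of a finite abelian group have the same order.
  have hcard : Nat.card T = Nat.card (G ⧸ (powMonoidHom p : G →* G).range) := by
    have h1 := T.card_mul_index
    have h2 := (powMonoidHom p : G →* G).range.card_mul_index
    rw [Subgroup.index_ker] at h1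
    rw [← h2, mul_comm] at h1
    exact Nat.eq_of_mul_eq_mul_left Nat.card_pos h1
  let : Module (ZMod p) (Additive T) := AddCommGroup.zmodModule fun x =>
    congrArg Additive.ofMul (Subtype.ext x.toMul.2 : x.toMul ^ p = 1)
  obtain ⟨f, hf⟩ := exists_injective_of_le_card (p := p) (r := r) (V := Additive T) (hcard ▸ h)
  exact ⟨T.subtype.comp (AddMonoidHom.toMultiplicativeLeft f),
    fun x y hxy => hf (Subtype.ext hxy)⟩

end Groups

/-! ### Kummer characters. -/

section Kummer

variable {K L : Type*} [Field K] [Field L] [Algebra K L]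

/-- The Kummer character attached to a `p`-th root of an element of `K`. -/
theorem exists_kummerCharacter {p : ℕ} (hp : p.Prime)
    (hroots : ∀ m : ℕ, ∃ ω : K, IsPrimitiveRoot ω (p ^ m)) {N : Subgroup (L ≃ₐ[K] L)} [N.Normal]
    (hN : ∀ σ ∈ N, ∃ τ, τ ^ p = σ) {c : Kˣ} {y : L} (hy : y ^ p = algebraMap K L c) :
    ∃ χ : (L ≃ₐ[K] L) ⧸ N →* L, ∀ σ : L ≃ₐ[K] L, σ y = χ σ * y := by
  have hy0 : y ≠ 0 := by
    rintro rfl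
    rw [zero_pow hp.ne_zero] at hy
    exact c.ne_zero ((map_eq_zero _).mp hy.symm)
  have hmem : y ∈ pRadicals p K L := ⟨1, c, by rw [pow_one, hy]⟩
  choose e he using exists_algebraMap_mul_of_mem_pRadicals hp hroots hmem
  let χ : (L ≃ₐ[K] L) →* L :=
    { toFun := fun σ => algebraMap K L (e σ)
      map_one' := by
        have h1 := he 1
        rw [AlgEquiv.one_apply] at h1
        exact mul_right_cancel₀ hy0 (by rw [← h1, one_mul])
      map_mul' := fun σ τ => by
        have h1 := he (σ * τ)
        rw [AlgEquiv.mul_apply, he τ, map_mul, AlgEquiv.commutes, he σ] at h1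
        exact mul_right_cancel₀ hy0 (by rw [← h1]; ring) }
  have hχ : ∀ σ, σ y = χ σ * y := he
  -- The character takes values in p-th roots of unity, so it is trivial on p-th powers.
  have hker : ∀ σ ∈ N, χ σ = 1 := by
    intro σ hσ
    obtain ⟨τ, rfl⟩ := hN σ hσ
    have h1 : (τ y) ^ p = y ^ p := by rw [← map_pow, hy, AlgEquiv.commutes]
    rw [hχ, mul_pow] at h1
    rw [map_pow]
    exact mul_right_cancel₀ (pow_ne_zero p hy0) (by rw [h1, one_mul])
  refine ⟨QuotientGroup.lift N χ hker, fun σ => ?_⟩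
  exact hχ σ

/-- Classes dying in L give characters of the quotient by N. Equal characters make y / y' Galois
invariant, so the classes agree; distinct characters are linearly independent functions, so there
are at most as many as elements of the quotient. -/
theorem card_ker_map_le [FiniteDimensional K L] [IsGalois K L] {p : ℕ} (hp : p.Prime)
    (hroots : ∀ m : ℕ, ∃ ω : K, IsPrimitiveRoot ω (p ^ m)) (N : Subgroup (L ≃ₐ[K] L)) [N.Normal]
    (hN : ∀ σ ∈ N, ∃ τ, τ ^ p = σ) :
    Nat.card (LinearMap.ker (PowClass.map p K L)) ≤ Nat.card ((L ≃ₐ[K] L) ⧸ N) := by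
  have hex : ∀ x : LinearMap.ker (PowClass.map p K L), ∃ (c : Kˣ) (y : L)
      (χ : (L ≃ₐ[K] L) ⧸ N →* L), PowClass.mk p c = x ∧ y ^ p = algebraMap K L c ∧
        ∀ σ : L ≃ₐ[K] L, σ y = χ σ * y := by
    rintro ⟨x, hx⟩
    obtain ⟨c, rfl⟩ := PowClass.mk_surjective x
    obtain ⟨y, hy⟩ := (PowClass.map_mk_eq_zero hp.ne_zero c).mp hx
    obtain ⟨χ, hχ⟩ := exists_kummerCharacter hp hroots hN hy
    exact ⟨c, y, χ, rfl, hy, hχ⟩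
  choose c y χ hc hy hχ using hex
  have hy0 : ∀ x, y x ≠ 0 := by
    intro x h0
    have h1 := hy x
    rw [h0, zero_pow hp.ne_zero] at h1
    exact (c x).ne_zero ((map_eq_zero _).mp h1.symm)
  have hinj : Function.Injective χ := by
    intro x x' hxx
    have hfix : ∀ σ : L ≃ₐ[K] L, σ (y x / y x') = y x / y x' := by
      intro σ
      have h0 : χ x' (σ : (L ≃ₐ[K] L) ⧸ N) ≠ 0 := by
        intro h0
        have h1 := hχ x' σ
        rw [h0, zero_mul, map_eq_zero] at h1
        exact hy0 x' h1
      rw [map_div₀, hχ, hχ, hxx, mul_div_mul_left _ _ h0]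
    obtain ⟨d, hd⟩ := (IsGalois.mem_range_algebraMap_iff_fixed (F := K) (y x / y x')).mpr hfix
    have hd0 : d ≠ 0 := by
      rintro rfl
      rw [map_zero] at hd
      exact div_ne_zero (hy0 x) (hy0 x') hd.symm
    apply Subtype.ext
    rw [← hc, ← hc, PowClass.mk_eq_mk]
    refine ⟨Units.mk0 d hd0, Units.ext ((algebraMap K L).injective ?_)⟩
    rw [Units.val_mul, Units.val_pow_eq_pow_val, Units.val_mk0, map_mul, map_pow, hd, ← hy, ← hy,
      div_pow, mul_div_cancel₀ _ (pow_ne_zero p (hy0 x'))]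
  have := Fintype.ofFinite ((L ≃ₐ[K] L) ⧸ N)
  have hli := linearIndependent_monoidHom ((L ≃ₐ[K] L) ⧸ N) L
  have hli' := hli.comp χ hinj
  have := hli'.finite
  have := Fintype.ofFinite (LinearMap.ker (PowClass.map p K L))
  have h1 := hli'.fintype_card_le_finrank
  rwa [Module.finrank_fintype_fun_eq_card, ← Nat.card_eq_fintype_card,
    ← Nat.card_eq_fintype_card] at h1

end Kummer

theorem HasElementaryAbelianSubgroup.le_pRank {p s : ℕ} (hp : p.Prime) {G : Type u} [Group G]
    [Finite G] (h : HasElementaryAbelianSubgroup p G s) : s ≤ pRank p G := by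
  refine le_csSup ⟨Nat.card G, ?_⟩ h
  rintro t ⟨H, ⟨e⟩⟩
  have : Fact p.Prime := ⟨hp⟩
  have h1 : Nat.card H = p ^ t := by
    rw [Nat.card_congr e.toEquiv, Nat.card_congr Multiplicative.toAdd]
    simp
  calc t ≤ p ^ t := (Nat.lt_pow_self hp.one_lt).le
    _ = Nat.card H := h1.symm
    _ ≤ Nat.card G := Nat.card_le_card_of_injective _ Subtype.val_injective

/-! ### The case of a p-group and the reduction to it. -/

section Main

variable {k : Type u} [Field k] [IsAlgClosed k] {p : ℕ}

theorem exists_isPrimitiveRoot_pow (hp : p.Prime) (hchar : ringChar k ≠ p) (m : ℕ) :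
    ∃ ω : k, IsPrimitiveRoot ω (p ^ m) := by
  have hpk : (p : k) ≠ 0 := by
    intro h0
    rcases (Nat.dvd_prime hp).mp (ringChar.dvd h0) with h | h
    · exact CharP.ringChar_ne_one h
    · exact hchar h
  have : NeZero ((p ^ m : ℕ) : k) := ⟨by rw [Nat.cast_pow]; exact pow_ne_zero _ hpk⟩
  exact HasEnoughRootsOfUnity.exists_primitiveRoot k (p ^ m)

variable {r : ℕ} {K : Type v} [Field K] [Algebra (IteratedLaurent k (2 * r)) K]
  [FiniteDimensional (IteratedLaurent k (2 * r)) K]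

/-- A Galois `p`-extension of a prime-to-`p` extension of `k((t₁))…((t₂ᵣ))` has the expected number
of `p`-th power classes, and its Galois group is commutative. -/
theorem finrank_powClass_and_comm [Fact p.Prime] {z : k} (hz : IsPrimitiveRoot (z ^ p) p)
    (hroots : ∀ m : ℕ, ∃ ω : k, IsPrimitiveRoot ω (p ^ m))
    (hdeg : ¬ p ∣ Module.finrank (IteratedLaurent k (2 * r)) K)
    {L : Type w} [Field L] [Algebra K L] [FiniteDimensional K L] [IsGalois K L]
    [Algebra (IteratedLaurent k (2 * r)) L] [IsScalarTower (IteratedLaurent k (2 * r)) K L]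
    (hG : IsPGroup p (L ≃ₐ[K] L)) :
    2 * r ≤ Module.finrank (ZMod p) (PowClass p L) ∧ ∀ σ τ : L ≃ₐ[K] L, σ * τ = τ * σ := by
  have hp : p.Prime := Fact.out
  set F := IteratedLaurent k (2 * r)
  have hM : ∀ M : IntermediateField K L, Module.Finite (ZMod p) (PowClass p M) ∧
      Module.finrank (ZMod p) (PowClass p M) ≤ 2 * r := by
    intro M
    have : FiniteDimensional F M := FiniteDimensional.trans F K M
    exact (IteratedLaurent.coveredByPow hp hz (2 * r) M).finite_and_finrank_le
  -- The upper bound 2r is attained: the variables stay independent, the degree being prime to p.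
  have hbot : Module.finrank (ZMod p) (PowClass p (⊥ : IntermediateField K L)) = 2 * r := by
    refine le_antisymm (hM ⊥).2 ?_
    have := (hM ⊥).1
    have : FiniteDimensional F (⊥ : IntermediateField K L) := FiniteDimensional.trans F K _
    have hd : ¬ p ∣ Module.finrank F (⊥ : IntermediateField K L) := by
      rwa [← Module.finrank_mul_finrank F K, IntermediateField.finrank_bot, mul_one]
    have h1 := (IteratedLaurent.linearIndependent_mk_varUnit k p (2 * r)).map'
      (PowClass.map p F (⊥ : IntermediateField K L))
      (LinearMap.ker_eq_bot.mpr (PowClass.map_injective_of_coprime _ hp hd))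
    simpa using h1.fintype_card_le_finrank
  have htop := IsRadicalStep.top hp hG
    (fun m => (hroots m).elim fun ω hω =>
      ⟨_, hω.map_of_injective
        ((algebraMap F K).comp (IteratedLaurent.const k (2 * r))).injective⟩)
    (fun M => (hM M).1) (fun M => (hM M).2) hbot
  refine ⟨?_, fun σ τ => AlgEquiv.ext fun x => htop.comm ⟨x, trivial⟩ σ τ⟩
  rw [← htop.finrank_eq]
  have : FiniteDimensional F L := FiniteDimensional.trans F K L
  have := (IteratedLaurent.coveredByPow hp hz (2 * r) L).finite_and_finrank_le.1
  refine LinearMap.finrank_le_finrank_of_injective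
    (f := PowClass.map p (⊤ : IntermediateField K L) L)
    (PowClass.map_injective_of_coprime _ hp ?_)
  rw [IntermediateField.finrank_top]
  exact hp.one_lt.not_ge ∘ Nat.le_of_dvd one_pos

theorem exists_injective_of_isPGroup [Fact p.Prime] {z : k} (hz : IsPrimitiveRoot (z ^ p) p)
    (hroots : ∀ m : ℕ, ∃ ω : k, IsPrimitiveRoot ω (p ^ m)) (hr : 0 < r)
    (hdeg : ¬ p ∣ Module.finrank (IteratedLaurent k (2 * r)) K)
    {L : Type w} [Field L] [Algebra K L] [FiniteDimensional K L] [IsGalois K L]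
    [Algebra (IteratedLaurent k (2 * r)) L] [IsScalarTower (IteratedLaurent k (2 * r)) K L]
    (hG : IsPGroup p (L ≃ₐ[K] L))
    (hsplit : IsSplitBy (IteratedLaurent k (2 * r)) (SymbolTensor k p (z ^ p) r) L) :
    ∃ f : Multiplicative (Fin r → ZMod p) →* (L ≃ₐ[K] L), Function.Injective f := by
  have hp : p.Prime := Fact.out
  obtain ⟨hrank, hcomm⟩ := finrank_powClass_and_comm hz hroots hdeg hG
  set F := IteratedLaurent k (2 * r)
  have : FiniteDimensional F L := FiniteDimensional.trans F K L
  -- L already has the maximal number of classes allowed to any finite extension of F.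
  have hL : PowClassBounded p L := by
    intro K₁ _ _ _
    let : Algebra F K₁ := ((algebraMap L K₁).comp (algebraMap F L)).toAlgebra
    have : IsScalarTower F L K₁ := IsScalarTower.of_algebraMap_eq fun _ => rfl
    have : FiniteDimensional F K₁ := FiniteDimensional.trans F L K₁
    obtain ⟨h1, h2⟩ := (IteratedLaurent.coveredByPow hp hz (2 * r) K₁).finite_and_finrank_le
    exact ⟨h1, h2.trans hrank⟩
  have hK := (IteratedLaurent.coveredByPow hp hz (2 * r) K).finite_and_finrank_le.1
  let s : (Fin r ⊕ Fin r → ZMod p) →ₗ[ZMod p] PowClass p F :=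
    Fintype.linearCombination (ZMod p) fun i => PowClass.mk p (IteratedLaurent.pairUnit k r i)
  have hs : Function.Injective s := linearIndependent_iff_injective_fintypeLinearCombination.mp
    (IteratedLaurent.linearIndependent_mk_pairUnit p r)
  let q := (PowClass.map p F L).comp s
  have h1 := le_finrank_ker_of_isSplitBy p r hz hr hL hsplit q fun i => by
    change PowClass.map p F L (s _) = _
    rw [Fintype.linearCombination_apply_single, one_smul]
  -- The relations found among the variables over L are classes of K that die in L, and they stay
  -- distinct because [K : F] is prime to p.
  let j : LinearMap.ker q →ₗ[ZMod p] LinearMap.ker (PowClass.map p K L) :=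
    ((PowClass.map p F K).comp s).restrict fun v hv => by
      rw [LinearMap.mem_ker, LinearMap.comp_apply, PowClass.map_map]
      exact hv
  have hj : Function.Injective j := by
    intro v w hvw
    exact Subtype.ext (hs (PowClass.map_injective_of_coprime K hp hdeg
      (congrArg Subtype.val hvw)))
  have h2 := h1.trans (LinearMap.finrank_le_finrank_of_injective hj)
  let : CommGroup (L ≃ₐ[K] L) := { (inferInstance : Group (L ≃ₐ[K] L)) with mul_comm := hcomm }
  have h3 := card_ker_map_le (K := K) (L := L) hp
    (fun m => (hroots m).elim fun ω hω =>
      ⟨_, hω.map_of_injective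
        ((algebraMap F K).comp (IteratedLaurent.const k (2 * r))).injective⟩)
    (powMonoidHom p : (L ≃ₐ[K] L) →* (L ≃ₐ[K] L)).range (fun σ ⟨τ, hτ⟩ => ⟨τ, hτ⟩)
  refine exists_injective_of_le_card_quotient (le_trans ?_ h3)
  rw [Module.natCard_eq_pow_finrank (K := ZMod p), Nat.card_zmod]
  exact Nat.pow_le_pow_right hp.pos h2

end Main

end

theorem mainTheorem2 {k : Type u} [Field k] [IsAlgClosed k]
    (p : ℕ) (hp : p.Prime) (hchar : ringChar k ≠ p)
    (ζ : k) (hζ : IsPrimitiveRoot ζ p) (r : ℕ) (hr : 0 < r)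
    (F' : Type v) [Field F'] [Algebra (IteratedLaurent k (2 * r)) F']
    [FiniteDimensional (IteratedLaurent k (2 * r)) F']
    (hdeg : ¬ p ∣ Module.finrank (IteratedLaurent k (2 * r)) F')
    (L : Type w) [Field L] [Algebra F' L] [FiniteDimensional F' L] [IsGalois F' L]
    [Algebra (IteratedLaurent k (2 * r)) L]
    [IsScalarTower (IteratedLaurent k (2 * r)) F' L]
    (hsplit : IsSplitBy (IteratedLaurent k (2 * r)) (SymbolTensor k p ζ r) L) :
    HasElementaryAbelianSubgroup p (L ≃ₐ[F'] L) r ∧ r ≤ pRank p (L ≃ₐ[F'] L) := by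
  have : Fact p.Prime := ⟨hp⟩
  -- From here on ζ is `z ^ p`, so that its powers are p-th powers in every extension.
  obtain ⟨z, rfl⟩ := IsAlgClosed.exists_pow_nat_eq ζ hp.pos
  suffices h : HasElementaryAbelianSubgroup p (L ≃ₐ[F'] L) r from ⟨h, h.le_pRank hp⟩
  let P : Sylow p (L ≃ₐ[F'] L) := default
  -- The degree of M over F' is the index of the Sylow subgroup, hence prime to p.
  let M := IntermediateField.fixedField (P : Subgroup (L ≃ₐ[F'] L))
  let e := IntermediateField.subgroupEquivAlgEquiv (P : Subgroup (L ≃ₐ[F'] L))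
  have hM : Module.finrank F' M = (P : Subgroup (L ≃ₐ[F'] L)).index := by
    have h1 := Module.finrank_mul_finrank F' M L
    rw [IntermediateField.finrank_fixedField_eq_card, ← IsGalois.card_aut_eq_finrank F' L,
      ← (P : Subgroup (L ≃ₐ[F'] L)).card_mul_index, mul_comm] at h1
    exact Nat.eq_of_mul_eq_mul_left Nat.card_pos h1
  have : FiniteDimensional (IteratedLaurent k (2 * r)) M := FiniteDimensional.trans _ F' M
  have : IsScalarTower (IteratedLaurent k (2 * r)) M L :=
    IsScalarTower.of_algebraMap_eq fun _ => rfl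
  have hdegM : ¬ p ∣ Module.finrank (IteratedLaurent k (2 * r)) M := by
    rw [← Module.finrank_mul_finrank (IteratedLaurent k (2 * r)) F' M, hM]
    exact hp.not_dvd_mul hdeg P.not_dvd_index
  obtain ⟨f, hf⟩ := exists_injective_of_isPGroup (L := L) hζ
    (exists_isPrimitiveRoot_pow hp hchar) hr hdegM (P.2.of_equiv e) hsplit
  exact hasElementaryAbelianSubgroup_of_injective
    ((P : Subgroup (L ≃ₐ[F'] L)).subtype.comp (e.symm.toMonoidHom.comp f))
    (Subtype.val_injective.comp (e.symm.injective.comp hf))
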